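/- Let $\delta\in(0,1/2)$ be a constant. For each $n$ let $p=p(n)\in[0,1]$ with $\frac{\log n}{n}\ll p\ll 1$, and let $\omega'=\omega'(n)$ be any function with $\omega'\to\infty$ and $\omega'=o(\log n)$ as $n\to\infty$ (here $f\ll g$ means $f=o(g)$). Consider the following asynchronous majority dynamics. Let $G=\mathcal G(n,p)$ be the binomial random graph on $V=\{1,\dots,n\}$; let $X(v)\in\{0,1\}$, $v\in V$, be i.i.d. private beliefs with $\mathbb P(X(v)=1)=1/2+\delta$; and let $v^1,v^2,\dots$ be i.i.d. uniformly random nodes of $V$; the graph, the beliefs and the selections are independent. Set $C^0(v)=\perp$ for all $v$. In round $t\ge1$ only the selected node $v^t$ updates its announcement: if $N_i$ denotes the number of neighbours $w$ of $v^t$ with $C^{t-1}(w)=i$, then $C^t(v^t)=1$ if $N_1>N_0$, $C^t(v^t)=0$ if $N_1<N_0$, and $C^t(v^t)=X(v^t)$ if $N_1=N_0$; for $v\ne v^t$, $C^t(v)=C^{t-1}(v)$. The process terminates at the first time $T$ at which no node would change its announcement if it were selected. Let $\hat T$ be the first time at which every node has been selected at least once. Then $n(\log n+\omega')=(1+o(1))\,n\log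 n$ and, with probability tending to $1$ as $n\to\infty$, the process terminates exactly at time $\hat T$, we have $\hat T\le n(\log n+\omega')$, and $C^t(v)=1$ (the correct opinion) for all nodes $v$ and all $t\ge\hat T$. -/

import Mathlib

open MeasureTheory ProbabilityTheory
open scoped Asymptotics

namespace MajorityDynamics

/-- A public announcement: `none` is `⊥` (nothing announced so far), `some true` is the correct
opinion `1` and `some false` is the incorrect opinion `0`. -/
abbrev Opinion := Option Bool

section Dynamics

variable {V : Type*} [Fintype V] [DecidableEq V]

open scoped Classical in
/-- `N_i(v)`: the number of neighbours of `v` whose current announcement is `i`. -/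
noncomputable def nbrCount (G : SimpleGraph V) (C : V → Opinion) (i : Opinion) (v : V) : ℕ :=
  (Finset.univ.filter fun w => G.Adj v w ∧ C w = i).card

/-- What `v` announces if selected when the current announcements are `C`: the majority opinion
among its neighbours, ties being broken by its private belief `X v`. -/
noncomputable def response (G : SimpleGraph V) (X : V → Bool) (C : V → Opinion) (v : V) : Bool :=
  if nbrCount G C (some false) v < nbrCount G C (some true) v then true
  else if nbrCount G C (some true) v < nbrCount G C (some false) v then false
  else X v

/-- One round: the selected node `v` updates its announcement, all others keep theirs. -/
noncomputable def step (G : SimpleGraph V) (X : V → Bool) (C : V → Opinion) (v : V) :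
    V → Opinion :=
  Function.update C v (some (response G X C v))

/-- The announcements `C^t` after `t` rounds; `s t` is the node selected in round `t + 1`. -/
noncomputable def announce (G : SimpleGraph V) (X : V → Bool) (s : ℕ → V) : ℕ → V → Opinion
  | 0 => fun _ => none
  | t + 1 => step G X (announce G X s t) (s t)

/-- The process has terminated: no node would change its announcement if it were selected. -/
def IsTerminal (G : SimpleGraph V) (X : V → Bool) (C : V → Opinion) : Prop :=
  ∀ v, step G X C v = C

/-- Every node has been selected at least once during the first `t` rounds. -/
def AllSelected (s : ℕ → V) (t : ℕ) : Prop :=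
  ∀ v, ∃ i < t, s i = v

end Dynamics

/-- The probability `1/2 + δ` that a private belief is correct. -/
noncomputable def correctProb (δ : ℝ) (hδ : δ ∈ Set.Ioo (0 : ℝ) (1 / 2)) : unitInterval :=
  ⟨1 / 2 + δ, by linarith [hδ.1], by linarith [hδ.2]⟩

/-- The randomness of the process on `n` nodes: a graph, the private beliefs, and the sequence of
selected nodes. -/
abbrev Sample (n : ℕ) := SimpleGraph (Fin n) × (Fin n → Bool) × (ℕ → Fin n)

/-- The joint law: the binomial random graph `G(n, p)`, i.i.d. private beliefs that are correct with
probability `q`, and i.i.d. uniformly selected nodes, all three independent. -/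
noncomputable def law (n : ℕ) (p q : unitInterval) : Measure (Sample n) :=
  (SimpleGraph.binomialRandom (Fin n) p).prod
    ((Measure.pi fun _ : Fin n => bernoulliMeasure true false q).prod
      (Measure.infinitePi fun _ : ℕ => uniformOn (Set.univ : Set (Fin n))))

/-- The first time `T` at which all nodes have been selected at least once is also the first time
at which the process has terminated, all nodes announce the correct opinion from time `T` on,
and `T ≤ b`. -/
def correctAtCouponTime (n : ℕ) (b : ℝ) : Set (Sample n) :=
  {x | ∃ T : ℕ,
    IsLeast {t | AllSelected x.2.2 t} T ∧
    IsLeast {t | IsTerminal x.1 x.2.1 (announce x.1 x.2.1 x.2.2 t)} T ∧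
    (∀ t, T ≤ t → ∀ v, announce x.1 x.2.1 x.2.2 t v = some true) ∧
    (T : ℝ) ≤ b}

end MajorityDynamics

/-! The private beliefs favour the correct opinion, and a node selected for the first time has
exposed none of its edges to the nodes that spoke before it. To isolate such first selections, the
process is bounded from below by `low`, in which every repeated selection yields the incorrect
opinion (`score_low_le`). Only first selections then consult the graph, and the coins they use are
disjoint from those that determine the history.

Fix a selection sequence with few repeats and let ε = `drift δ`. As long as p times the number of
announcements is at most δ/2, a new node probably sees no announcement and follows its belief.
Later, a bias of at least ε times the number of announcements sustains itself: by
`coins_wrong_majority_le` a new node errs with probability at most 1/2 - ε. The bias thus gains 2ε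
in expectation per fresh round, twice what is required, and an exponential supermartingale
(`expBias_le`) shows that it stays above ε t from round a of order 1/p on, up to a probability
geometrically small in a. After t₀ of order log n / p rounds, Chernoff's inequality makes each new
response correct with probability at least 1 - n⁻². After t₁ = 10 t₀ rounds the nodes selected
exactly once since t₀ outweigh all others in every neighbourhood
(`seedLaw_exists_margin_nonpos_le`). This state is absorbing (`margin_announce_pos`), and any node
selected from then on is correct forever.

For the selections, p ≫ log n / n gives t₁ = o(n), so repeats are rare in all relevant prefixes
(`selectionLaw_many_repeats_le`). By symmetry, the last node to appear from round t₁ on was probably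
not selected earlier (`selectionLaw_isLastFrom_le`). Hence at the coupon time every node has been
selected after t₁ and all are correct; earlier, a silent node would still change. The coupon
collector's bound, applied after the o(n) initial rounds, bounds this time. -/

namespace MajorityDynamics

set_option linter.unusedSectionVars false

/-! ### Monotonicity, absorption and the coupon time for fixed randomness -/

section Deterministic

variable {V : Type*} [Fintype V] [DecidableEq V]

/-- The contribution of an announcement to the majority count: `+1` for the correct opinion,
`-1` for the incorrect one. -/
def score : Opinion → ℤ
  | none => 0
  | some true => 1
  | some false => -1

open scoped Classical in
/-- The number of correct minus the number of incorrect announcements among the neighbours. -/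
noncomputable def margin (G : SimpleGraph V) (C : V → Opinion) (v : V) : ℤ :=
  ∑ w, if G.Adj v w then score (C w) else 0

lemma margin_eq_sub (G : SimpleGraph V) (C : V → Opinion) (v : V) :
    margin G C v = nbrCount G C (some true) v - nbrCount G C (some false) v := by
  classical
  simp only [margin, nbrCount, Finset.card_filter, Nat.cast_sum, ← Finset.sum_sub_distrib]
  refine Finset.sum_congr rfl fun w _ => ?_
  by_cases h : G.Adj v w
  · rcases hC : C w with _ | _ | _ <;> simp [h, score]
  · simp [h]

lemma margin_mono (G : SimpleGraph V) {C C' : V → Opinion} (h : ∀ w, score (C w) ≤ score (C' w))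
    (v : V) : margin G C v ≤ margin G C' v := by
  classical
  refine Finset.sum_le_sum fun w _ => ?_
  split_ifs
  exacts [h w, le_rfl]

lemma response_eq (G : SimpleGraph V) (X : V → Bool) (C : V → Opinion) (v : V) :
    response G X C v =
      if 0 < margin G C v then true else if margin G C v < 0 then false else X v := by
  rw [margin_eq_sub]
  unfold response
  split_ifs <;> first | rfl | omega

/-- Breaking ties by the belief is an intermediate rule between the two majorities, so raising
announcements can only move a response upwards. This is what makes the comparison with `low`
possible. -/
lemma response_mono (G : SimpleGraph V) (X : V → Bool) {C C' : V → Opinion}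
    (h : ∀ w, score (C w) ≤ score (C' w)) (v : V) (hr : response G X C v = true) :
    response G X C' v = true := by
  have := margin_mono G h v
  rw [response_eq] at hr ⊢
  split_ifs at hr ⊢ <;> first | rfl | omega

lemma score_some_le_one (o : Opinion) : score o ≤ score (some true) := by
  rcases o with _ | _ | _ <;> simp [score]

lemma score_some_false_le (o : Opinion) : score (some false) ≤ score o := by
  rcases o with _ | _ | _ <;> simp [score]

lemma announce_eq_none_iff (G : SimpleGraph V) (X : V → Bool) (s : ℕ → V) (t : ℕ) (v : V) :
    announce G X s t v = none ↔ ∀ i < t, s i ≠ v := by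
  induction t with
  | zero => simp [announce]
  | succ t ih =>
    by_cases h : s t = v
    · simp only [announce, step, h, Function.update_self]
      simp only [reduceCtorEq, ne_eq, false_iff, not_forall]
      exact ⟨t, by omega, by simpa using h⟩
    · simp only [announce, step]
      rw [Function.update_of_ne (Ne.symm h), ih]
      refine ⟨fun H i hi => ?_, fun H i hi => H i (by omega)⟩
      rcases Nat.lt_succ_iff_lt_or_eq.1 hi with h' | rfl
      exacts [H i h', h]

/-- A node with positive margin answers with the opinion of highest score, so no update lowers any
margin: the condition is absorbing. -/
lemma margin_announce_pos {G : SimpleGraph V} {X : V → Bool} {s : ℕ → V} {t₁ : ℕ}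
    (h : ∀ v, 0 < margin G (announce G X s t₁) v) {t : ℕ} (ht : t₁ ≤ t) (v : V) :
    0 < margin G (announce G X s t) v := by
  induction t, ht using Nat.le_induction generalizing v with
  | base => exact h v
  | succ t _ ih =>
    refine (ih v).trans_le (margin_mono G (fun w => ?_) v)
    by_cases hw : w = s t
    · subst hw
      simp only [announce, step, Function.update_self]
      rw [response_eq, if_pos (ih _)]
      exact score_some_le_one _
    · simp only [announce, step]
      rw [Function.update_of_ne hw]

lemma announce_eq_true {G : SimpleGraph V} {X : V → Bool} {s : ℕ → V} {t₁ : ℕ}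
    (h : ∀ v, 0 < margin G (announce G X s t₁) v) {i t : ℕ} (hi : t₁ ≤ i) (hit : i < t) :
    announce G X s t (s i) = some true := by
  induction t, (Nat.succ_le_of_lt hit) using Nat.le_induction with
  | base =>
    simp only [announce, step, Function.update_self]
    rw [response_eq, if_pos (margin_announce_pos h hi _)]
  | succ t ht ih =>
    have ht' : i + 1 ≤ t := ht
    simp only [announce, step]
    by_cases hw : s i = s t
    · rw [hw, Function.update_self, response_eq, if_pos (margin_announce_pos h (by omega) _)]
    · rw [Function.update_of_ne hw]
      exact ih (by omega)

/-- Among the selections from round `t₁` on, `v` is the last node to make its first appearance. -/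
def IsLastFrom (t₁ : ℕ) (s : ℕ → V) (v : V) : Prop :=
  ∀ w, w ≠ v → ∃ j, t₁ ≤ j ∧ s j = w ∧ ∀ i, t₁ ≤ i → i ≤ j → s i ≠ v

lemma IsLastFrom.unique {t₁ : ℕ} {s : ℕ → V} {v w : V} (hv : IsLastFrom t₁ s v)
    (hw : IsLastFrom t₁ s w) : v = w := by
  by_contra hne
  obtain ⟨j, hj, hjw, hj'⟩ := hv w (Ne.symm hne)
  obtain ⟨k, hk, hkv, hk'⟩ := hw v hne
  rcases le_total k j with h | h
  · exact hj' k hk h hkv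
  · exact hk' j hj h hjw

/-- If every node makes an appearance from round `t₁` on, before round `b`, and the last one to do
so had not been selected before `t₁`, then all nodes are selected between `t₁` and the first time
all nodes have been selected. -/
lemma exists_isLeast_allSelected [Nonempty V] {t₁ b : ℕ} {s : ℕ → V}
    (hcover : ∀ v, ∃ i, t₁ ≤ i ∧ i < b ∧ s i = v) (hlast : ∀ i < t₁, ¬ IsLastFrom t₁ s (s i)) :
    ∃ T, IsLeast {t | AllSelected s t} T ∧ T ≤ b ∧ ∀ v, ∃ i, t₁ ≤ i ∧ i < T ∧ s i = v := by
  classical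
  have hex : ∃ t, AllSelected s t := ⟨b, fun v => (hcover v).imp fun i hi => ⟨hi.2.1, hi.2.2⟩⟩
  have hvis : ∀ v, ∃ i, t₁ ≤ i ∧ s i = v := fun v => (hcover v).imp fun i hi => ⟨hi.1, hi.2.2⟩
  obtain ⟨v, -, hv⟩ := Finset.exists_max_image Finset.univ (fun v => Nat.find (hvis v))
    Finset.univ_nonempty
  have hlastv : IsLastFrom t₁ s v := by
    intro w hw
    refine ⟨Nat.find (hvis w), (Nat.find_spec (hvis w)).1, (Nat.find_spec (hvis w)).2, ?_⟩
    intro i hi hiw hiv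
    have h1 : Nat.find (hvis v) ≤ i := Nat.find_min' _ ⟨hi, hiv⟩
    have h2 := hv w (Finset.mem_univ _)
    have h3 : Nat.find (hvis w) = Nat.find (hvis v) := by omega
    apply hw
    rw [← (Nat.find_spec (hvis w)).2, ← (Nat.find_spec (hvis v)).2, h3]
  refine ⟨Nat.find hex, ⟨Nat.find_spec hex, fun t ht => Nat.find_min' _ ht⟩,
    Nat.find_min' _ fun v => (hcover v).imp fun i hi => ⟨hi.2.1, hi.2.2⟩, fun w => ?_⟩
  -- The selection of `v` before the coupon time cannot precede `t₁`, so the coupon time lies beyond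
  -- the first appearance of `v` after `t₁`, which is the latest among all nodes.
  obtain ⟨i, hi, hiv⟩ := Nat.find_spec hex v
  have hit : t₁ ≤ i := by
    by_contra hlt
    exact hlast i (by omega) (hiv ▸ hlastv)
  have h1 : Nat.find (hvis v) ≤ i := Nat.find_min' _ ⟨hit, hiv⟩
  have h2 := hv w (Finset.mem_univ _)
  exact ⟨Nat.find (hvis w), (Nat.find_spec (hvis w)).1, by omega, (Nat.find_spec (hvis w)).2⟩

/-- At the coupon time every node has been selected since `t₁` with a positive margin, so all are
correct and none would change. At any earlier time an unselected node still has `none`, which a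
selection would replace, so the state is not terminal. -/
lemma mem_correctAtCouponTime {n : ℕ} [NeZero n] {b : ℝ} (hb : 0 ≤ b) {G : SimpleGraph (Fin n)}
    {X : Fin n → Bool} {s : ℕ → Fin n} {t₁ : ℕ}
    (hmargin : ∀ v, 0 < margin G (announce G X s t₁) v)
    (hcover : ∀ v, ∃ i, t₁ ≤ i ∧ i < ⌊b⌋₊ ∧ s i = v)
    (hlast : ∀ i < t₁, ¬ IsLastFrom t₁ s (s i)) :
    (G, X, s) ∈ correctAtCouponTime n b := by
  obtain ⟨T, hT, hTb, hTs⟩ := exists_isLeast_allSelected hcover hlast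
  have htrue : ∀ t, T ≤ t → ∀ v, announce G X s t v = some true := by
    intro t ht v
    obtain ⟨i, hi, hiT, rfl⟩ := hTs v
    exact announce_eq_true hmargin hi (hiT.trans_le ht)
  have hT₁ : t₁ ≤ T := by
    obtain ⟨i, hi, hiT, -⟩ := hTs 0
    omega
  refine ⟨T, hT, ⟨fun v => ?_, fun t ht => hT.2 fun v => ?_⟩, htrue,
    (Nat.cast_le.2 hTb).trans (Nat.floor_le hb)⟩
  · have : response G X (announce G X s T) v = true := by
      rw [response_eq, if_pos (margin_announce_pos hmargin hT₁ v)]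
    simp only [step, this]
    rw [← htrue T le_rfl v, Function.update_eq_self]
  · by_contra hne
    have hnone : announce G X s t v = none :=
      (announce_eq_none_iff G X s t v).2 fun i hi hiv => hne ⟨i, hi, hiv⟩
    have := congrFun (ht v) v
    simp only [step, Function.update_self] at this
    rw [hnone] at this
    exact absurd this (by simp)

/-- A pessimistic version of `announce`: a node selected again switches to the incorrect
opinion. -/
noncomputable def low (G : SimpleGraph V) (X : V → Bool) (s : ℕ → V) : ℕ → V → Opinion
  | 0 => fun _ => none
  | t + 1 => Function.update (low G X s t) (s t)
      (some (if low G X s t (s t) = none then response G X (low G X s t) (s t) else false))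

lemma low_eq_none_iff (G : SimpleGraph V) (X : V → Bool) (s : ℕ → V) (t : ℕ) (v : V) :
    low G X s t v = none ↔ ∀ i < t, s i ≠ v := by
  induction t with
  | zero => simp [low]
  | succ t ih =>
    by_cases h : s t = v
    · simp only [low, h, Function.update_self]
      simp only [reduceCtorEq, ne_eq, false_iff, not_forall]
      exact ⟨t, by omega, by simpa using h⟩
    · simp only [low]
      rw [Function.update_of_ne (Ne.symm h), ih]
      refine ⟨fun H i hi => ?_, fun H i hi => H i (by omega)⟩
      rcases Nat.lt_succ_iff_lt_or_eq.1 hi with h' | rfl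
      exacts [H i h', h]

/-- First responses compare by `response_mono`, and a repeated selection in `low` receives the least
score of all. -/
lemma score_low_le (G : SimpleGraph V) (X : V → Bool) (s : ℕ → V) (t : ℕ) (v : V) :
    score (low G X s t v) ≤ score (announce G X s t v) := by
  induction t generalizing v with
  | zero => simp [low, announce]
  | succ t ih =>
    by_cases h : v = s t
    · subst h
      simp only [low, announce, step, Function.update_self]
      split_ifs with hnone
      · cases hr : response G X (low G X s t) (s t)
        · exact score_some_false_le _
        · rw [response_mono G X ih _ hr]
      · exact score_some_false_le _
    · simp only [low, announce, step]
      rw [Function.update_of_ne h, Function.update_of_ne h]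
      exact ih v

lemma margin_low_le (G : SimpleGraph V) (X : V → Bool) (s : ℕ → V) (t : ℕ) (v : V) :
    margin G (low G X s t) v ≤ margin G (announce G X s t) v :=
  margin_mono G (score_low_le G X s t) v

end Deterministic

/-! ### Independent coin counts: moments and a Chernoff bound -/

section Binomial

/-- Events determined by disjoint sets of coordinates of a product measure are independent. -/
lemma infinitePi_inter_of_dependsOn {ι : Type*} [Fintype ι] {Ω : ι → Type*}
    [∀ i, MeasurableSpace (Ω i)] [∀ i, Finite (Ω i)] [∀ i, MeasurableSingletonClass (Ω i)]
    (μ : ∀ i, Measure (Ω i)) [∀ i, IsProbabilityMeasure (μ i)] {S T : Finset ι}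
    (hST : Disjoint S T) {E F : (∀ i, Ω i) → Prop} (hE : DependsOn E (S : Set ι))
    (hF : DependsOn F (T : Set ι)) :
    (Measure.infinitePi μ).real {ω | E ω ∧ F ω} =
      (Measure.infinitePi μ).real {ω | E ω} * (Measure.infinitePi μ).real {ω | F ω} := by
  obtain ⟨e, rfl⟩ := dependsOn_iff_exists_comp.1 hE
  obtain ⟨f, rfl⟩ := dependsOn_iff_exists_comp.1 hF
  have hind := (iIndepFun_infinitePi (P := μ) (X := fun i ω => ω)
    (fun i => measurable_id)).indepFun_finset S T hST (fun i => measurable_pi_apply i)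
  have := hind.measure_inter_preimage_eq_mul {x | e x} {x | f x}
    (Set.toFinite _).measurableSet (Set.toFinite _).measurableSet
  simp only [measureReal_def]
  rw [← ENNReal.toReal_mul]
  exact congrArg _ this

variable {ι : Type*} [Fintype ι] [DecidableEq ι]

/-- The number of indices in `S` at which `x` is `true`. -/
def hits (S : Finset ι) (x : ι → Bool) : ℕ := ∑ i ∈ S, (x i).toNat

/-- The law of independent biased coin flips. -/
noncomputable abbrev coins (ι : Type*) (p : unitInterval) : Measure (ι → Bool) :=
  Measure.infinitePi fun _ : ι => bernoulliMeasure true false p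

lemma hits_union {S T : Finset ι} (h : Disjoint S T) (x : ι → Bool) :
    hits (S ∪ T) x = hits S x + hits T x := Finset.sum_union h

lemma map_hits_eq (p : unitInterval) (S : Finset ι) :
    (coins ι p).map (hits S) = (coins (Fin S.card) p).map (hits Finset.univ) := by
  have hinj : Function.Injective (fun i : Fin S.card => ((S.equivFin.symm i : S) : ι)) :=
    Subtype.val_injective.comp S.equivFin.symm.injective
  have := Measure.map_infinitePi_infinitePi_of_inj
    (P := fun _ : ι => bernoulliMeasure true false p) hinj
  simp only [coins]
  rw [← this, Measure.map_map .of_discrete (by fun_prop)]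
  congr 1
  funext x
  simp only [hits, Function.comp]
  rw [← Finset.sum_coe_sort S, ← Equiv.sum_comp S.equivFin.symm]

lemma indepFun_hits (p : unitInterval) {S T : Finset ι} (h : Disjoint S T) :
    IndepFun (hits S) (hits T) (coins ι p) := by
  have hind := (iIndepFun_infinitePi (P := fun _ : ι => bernoulliMeasure true false p)
    (X := fun i ω => ω) (fun i => measurable_id)).indepFun_finset S T h
      (fun i => measurable_pi_apply i)
  have := hind.comp (φ := fun x : S → Bool => ∑ i, (x i).toNat)
    (ψ := fun x : T → Bool => ∑ i, (x i).toNat) .of_discrete .of_discrete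
  convert this using 1
  · funext x; simp only [hits, Function.comp]; rw [← Finset.sum_coe_sort S]
  · funext x; simp only [hits, Function.comp]; rw [← Finset.sum_coe_sort T]

/-- Turns the comparison of two groups of unequal size into a product law: the larger group is an
independent copy of the smaller one plus a remainder `T`, which makes symmetrisation possible. -/
lemma map_hits_triple (p : unitInterval) {S S' T : Finset ι} (h : Disjoint S S')
    (h' : Disjoint (S ∪ S') T) (hcard : S'.card = S.card) :
    (coins ι p).map (fun x => ((hits S x, hits S' x), hits T x)) =
      (((coins ι p).map (hits S)).prod ((coins ι p).map (hits S))).prod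
        ((coins ι p).map (hits T)) := by
  have h2 : (coins ι p).map (hits S') = (coins ι p).map (hits S) := by
    rw [map_hits_eq p S, map_hits_eq p S', hcard]
  have hind := (iIndepFun_infinitePi (P := fun _ : ι => bernoulliMeasure true false p)
    (X := fun i ω => ω) (fun i => measurable_id)).indepFun_finset (S ∪ S') T h'
      (fun i => measurable_pi_apply i)
  have hind' := hind.comp (φ := fun x : ↥(S ∪ S') → Bool =>
      ((∑ i : S, (x ⟨i, Finset.mem_union_left _ i.2⟩).toNat),
        (∑ i : S', (x ⟨i, Finset.mem_union_right _ i.2⟩).toNat)))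
    (ψ := fun x : T → Bool => ∑ i, (x i).toNat) .of_discrete .of_discrete
  have h3 : IndepFun (fun x => (hits S x, hits S' x)) (hits T) (coins ι p) := by
    convert hind' using 1
    · funext x; simp only [hits, Function.comp]
      rw [← Finset.sum_coe_sort S, ← Finset.sum_coe_sort S']
    · funext x; simp only [hits, Function.comp]; rw [← Finset.sum_coe_sort T]
  rw [(indepFun_iff_map_prod_eq_prod_map_map Measurable.of_discrete.aemeasurable
    Measurable.of_discrete.aemeasurable).1 h3,
    (indepFun_iff_map_prod_eq_prod_map_map Measurable.of_discrete.aemeasurable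
    Measurable.of_discrete.aemeasurable).1 (indepFun_hits p h), h2]

lemma integral_coin (p : unitInterval) (i : ι) (f : Bool → ℝ) :
    ∫ x, f (x i) ∂(coins ι p) = p * f true + (1 - p) * f false := by
  have := Measure.infinitePi_map_eval (fun _ : ι => bernoulliMeasure true false p) i
  rw [← integral_map (φ := fun x : ι → Bool => x i) (f := f)
    (measurable_pi_apply i).aemeasurable (by fun_prop)]
  erw [this]
  rw [integral_bernoulliMeasure]
  simp

lemma integral_hits (p : unitInterval) (S : Finset ι) :
    ∫ x, (hits S x : ℝ) ∂(coins ι p) = p * S.card := by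
  simp only [hits, Nat.cast_sum]
  rw [integral_finsetSum _ fun i _ => Integrable.of_finite]
  simp only [integral_coin p _ (fun b => ((b.toNat : ℕ) : ℝ))]
  simp [mul_comm]

lemma variance_hits_le (p : unitInterval) (S : Finset ι) :
    variance (fun x => (hits S x : ℝ)) (coins ι p) ≤ p * S.card := by
  have hsum : (fun x : ι → Bool => (hits S x : ℝ)) = ∑ i ∈ S, fun x => ((x i).toNat : ℝ) := by
    funext x
    simp [hits]
  rw [hsum, IndepFun.variance_sum]
  · refine (Finset.sum_le_card_nsmul S _ (p : ℝ) fun i _ => ?_).trans (by simp [mul_comm])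
    refine (variance_le_expectation_sq Measurable.of_discrete.aestronglyMeasurable).trans ?_
    have := integral_coin p i (fun b => ((b.toNat : ℕ) : ℝ) ^ 2)
    simp only [Pi.pow_apply]
    rw [this]
    simp
  · exact fun i _ => MemLp.of_discrete
  · intro i _ j _ hij
    have := ((iIndepFun_infinitePi (P := fun _ : ι => bernoulliMeasure true false p)
      (X := fun i ω => (ω.toNat : ℝ)) (fun i => .of_discrete)).indepFun hij)
    exact this

lemma integral_hits_sq_le (p : unitInterval) (S : Finset ι) :
    ∫ x, (hits S x : ℝ) ^ 2 ∂(coins ι p) ≤ p * S.card + (p * S.card) ^ 2 := by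
  have h := variance_hits_le p S
  rw [variance_eq_sub MemLp.of_discrete, integral_hits] at h
  simp only [Pi.pow_apply] at h
  linarith

/-- Chernoff bound comparing the number of hits in two disjoint sets. -/
lemma coins_hits_le_hits (p : unitInterval) {ε : ℝ} (hε : 0 ≤ ε) {A B : Finset ι}
    (hAB : Disjoint A B) (h : ε * (A.card + B.card) ≤ (A.card : ℝ) - B.card) :
    (coins ι p).real {x | hits A x ≤ hits B x} ≤
      Real.exp (-(p * ε ^ 2 * (A.card + B.card) / 4)) := by
  -- Base of the exponential moment of `hits B - hits A`. Being rational in ε, it reduces the final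
  -- estimate to a polynomial inequality.
  set y : ℝ := 1 + ε / 2 with hy
  have hy1 : 1 ≤ y := by simp only [hy]; linarith
  have hy0 : 0 < y := by linarith
  have hp0 : (0 : ℝ) ≤ p := p.2.1
  have hp1 : (p : ℝ) ≤ 1 := p.2.2
  let c : ι → ℝ := fun i => if i ∈ A then y⁻¹ else if i ∈ B then y else 1
  have hc : ∀ i, 0 < c i := by
    intro i; simp only [c]; split_ifs <;> positivity
  let f : (ι → Bool) → ℝ := fun x => ∏ i, (if x i then c i else 1)
  have hf : ∀ x, f x = y ^ (hits B x) * (y⁻¹) ^ (hits A x) := by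
    intro x
    have h1 : ∀ i, (if x i then c i else 1) =
        (if i ∈ B then y ^ (x i).toNat else 1) * (if i ∈ A then (y⁻¹) ^ (x i).toNat else 1) := by
      intro i
      have : i ∈ A → i ∉ B := fun hi => Finset.disjoint_left.1 hAB hi
      cases x i <;> by_cases hA : i ∈ A <;> by_cases hB : i ∈ B <;> simp_all [c]
    simp only [f, h1, Finset.prod_mul_distrib, hits, ← Finset.prod_pow_eq_pow_sum]
    simp
  have hmark : (coins ι p).real {x | hits A x ≤ hits B x} ≤ ∫ x, f x ∂(coins ι p) := by
    rw [← integral_indicator_one (Set.toFinite _).measurableSet]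
    refine integral_mono Integrable.of_finite Integrable.of_finite fun x => ?_
    simp only
    by_cases hx : hits A x ≤ hits B x
    · rw [Set.indicator_of_mem (by exact hx), hf]
      have : y ^ hits A x * (y⁻¹) ^ (hits A x) = 1 := by
        rw [← mul_pow, mul_inv_cancel₀ hy0.ne', one_pow]
      simp only [Pi.one_apply]
      rw [← this]
      gcongr
    · rw [Set.indicator_of_notMem (by exact hx)]
      exact Finset.prod_nonneg fun i _ => by split_ifs <;> [exact (hc i).le; norm_num]
  have hintegral : ∫ x, f x ∂(coins ι p) = ∏ i, (p * c i + (1 - p)) := by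
    have h1 : coins ι p = Measure.pi fun _ : ι => bernoulliMeasure true false p :=
      Measure.infinitePi_eq_pi _
    rw [h1]
    simp only [f]
    rw [integral_fintype_prod_eq_prod (fun i (b : Bool) => if b then c i else (1 : ℝ))]
    refine Finset.prod_congr rfl fun i _ => ?_
    rw [integral_bernoulliMeasure]
    simp
  have hprod : ∏ i, (p * c i + (1 - p)) ≤ Real.exp (∑ i, p * (c i - 1)) := by
    rw [Real.exp_sum]
    refine Finset.prod_le_prod (fun i _ => ?_) fun i _ => ?_
    · have := mul_nonneg hp0 (hc i).le
      linarith
    · have := Real.add_one_le_exp (p * (c i - 1))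
      linarith
  have hsum : ∑ i, (p : ℝ) * (c i - 1) = p * (A.card * (y⁻¹ - 1) + B.card * (y - 1)) := by
    have h1 : ∀ i, c i - 1 = (if i ∈ A then y⁻¹ - 1 else 0) + (if i ∈ B then y - 1 else 0) := by
      intro i
      have : i ∈ A → i ∉ B := fun hi => Finset.disjoint_left.1 hAB hi
      by_cases hA : i ∈ A <;> by_cases hB : i ∈ B <;> simp_all [c]
    rw [← Finset.mul_sum]
    simp only [h1, Finset.sum_add_distrib, Finset.sum_ite_mem, Finset.univ_inter, Finset.sum_const,
      nsmul_eq_mul]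
  refine hmark.trans (hintegral.le.trans (hprod.trans ?_))
  rw [Real.exp_le_exp, hsum]
  have key : (A.card : ℝ) * (y⁻¹ - 1) + B.card * (y - 1) ≤ -(ε ^ 2 * (A.card + B.card) / 4) := by
    have e : (A.card : ℝ) * (y⁻¹ - 1) + B.card * (y - 1) = -(ε / 2) * ((A.card - B.card * y) / y) := by
      field_simp
      simp only [hy]
      ring
    rw [e]
    have h2 : ε * (A.card + B.card) / 2 ≤ (A.card - B.card * y) / y := by
      rw [le_div_iff₀ hy0]
      have hA : (0 : ℝ) ≤ A.card := by positivity
      have hB : (0 : ℝ) ≤ B.card := by positivity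
      simp only [hy]
      nlinarith [mul_nonneg hε hA, mul_nonneg hε hB, mul_nonneg (mul_nonneg hε hε) hB,
        mul_nonneg (mul_nonneg hε hε) hA, mul_le_mul_of_nonneg_left h hε]
    nlinarith [mul_le_mul_of_nonneg_left h2 (by positivity : 0 ≤ ε / 2)]
  nlinarith [mul_le_mul_of_nonneg_left key hp0]

end Binomial

/-! ### A linear bias reproduces itself -/

section Drift

/-- Two independent samples of a concentrated distribution are likely to be close together. -/
lemma le_prod_dist_lt (β : Measure ℕ) [IsProbabilityMeasure β] {m r : ℝ} (hm : 0 ≤ m) (hr : 0 ≤ r)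
    (hconc : 3 / 4 ≤ β.real {y : ℕ | |(y : ℝ) - m| < r}) {k : ℕ} (hk : 0 < k) :
    9 / 16 * (k / (2 * r + 2 * k)) ≤
      (β.prod β).real {z | |(z.1 : ℝ) - z.2| < k} := by
  have hk' : (0 : ℝ) < k := by exact_mod_cast hk
  -- Cut ℕ into blocks of length `k`; `J` contains the blocks that meet the interval of radius `r`
  -- about `m`. Truncating its left end at zero does no harm.
  set J : Finset ℕ := Finset.Icc ⌈(m - r) / k - 1⌉₊ ⌊(m + r) / k⌋₊ with hJ
  have hJcard : (J.card : ℝ) ≤ 2 * r / k + 2 := by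
    have h1 : (⌊(m + r) / k⌋₊ : ℝ) ≤ (m + r) / k := Nat.floor_le (by positivity)
    have h2 : (m - r) / k - 1 ≤ (⌈(m - r) / k - 1⌉₊ : ℝ) := Nat.le_ceil _
    have h3 : (m + r) / k - ((m - r) / k - 1) + 1 = 2 * r / k + 2 := by ring
    rw [hJ, Nat.card_Icc]
    rcases le_total ⌈(m - r) / k - 1⌉₊ (⌊(m + r) / k⌋₊ + 1) with h | h
    · rw [Nat.cast_sub h]
      push_cast
      linarith
    · rw [Nat.sub_eq_zero_of_le h]
      have : 0 ≤ 2 * r / k := by positivity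
      push_cast
      linarith
  have hmem : ∀ y : ℕ, |(y : ℝ) - m| < r → y / k ∈ J := by
    intro y hy
    rw [abs_lt] at hy
    have h1 : ((y / k : ℕ) : ℝ) ≤ y / k := Nat.cast_div_le
    have h2 : (y : ℝ) / k < (y / k : ℕ) + 1 := by
      rw [div_lt_iff₀ hk']
      exact_mod_cast (Nat.lt_mul_of_div_lt (Nat.lt_succ_self (y / k)) hk)
    rw [hJ, Finset.mem_Icc, Nat.ceil_le, Nat.le_floor_iff (by positivity)]
    constructor
    · have : (m - r) / k < y / k := by gcongr; linarith
      linarith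
    · refine h1.trans ?_
      gcongr
      linarith
  have hJpos : (0 : ℝ) < 2 * r / k + 2 := by positivity
  set b : ℕ → ℝ := fun j => β.real {y | y / k = j}
  have hsum : 3 / 4 ≤ ∑ j ∈ J, b j := by
    refine hconc.trans ?_
    have : {y : ℕ | |(y : ℝ) - m| < r} ⊆ ⋃ j ∈ J, {y | y / k = j} := fun y hy => by
      simpa using hmem y hy
    exact (measureReal_mono this (measure_ne_top _ _)).trans (measureReal_biUnion_finset_le _ _)
  have hsq : ∑ j ∈ J, b j ^ 2 ≤ (β.prod β).real {z | |(z.1 : ℝ) - z.2| < k} := by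
    have h1 : ∀ j, b j ^ 2 = (β.prod β).real ({y | y / k = j} ×ˢ {y | y / k = j}) := by
      intro j
      rw [measureReal_prod_prod, sq]
    simp only [h1]
    rw [← measureReal_biUnion_finset]
    · refine measureReal_mono ?_ (measure_ne_top _ _)
      intro z hz
      simp only [Set.mem_iUnion, Set.mem_prod, Set.mem_ofPred_eq] at hz
      obtain ⟨j, -, h1, h2⟩ := hz
      have e1 := Nat.div_add_mod z.1 k
      have e2 := Nat.div_add_mod z.2 k
      have l1 := Nat.mod_lt z.1 hk
      have l2 := Nat.mod_lt z.2 hk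
      rw [h1] at e1
      rw [h2] at e2
      simp only [Set.mem_ofPred_eq]
      rw [abs_lt]
      constructor
      · have : z.2 < z.1 + k := by omega
        have : (z.2 : ℝ) < z.1 + k := by exact_mod_cast this
        linarith
      · have : z.1 < z.2 + k := by omega
        have : (z.1 : ℝ) < z.2 + k := by exact_mod_cast this
        linarith
    · intro i _ j _ hij
      rw [Function.onFun, Set.disjoint_left]
      rintro z ⟨h1, -⟩ ⟨h2, -⟩
      exact hij (h1.symm.trans h2)
    · exact fun _ _ => MeasurableSet.of_discrete
  -- Cauchy–Schwarz: mass at least 3/4 spread over the blocks of `J` puts both samples into one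
  -- block, hence at distance below `k`, with probability at least (3/4)² / |J|.
  have hcs : (∑ j ∈ J, b j) ^ 2 ≤ J.card * ∑ j ∈ J, b j ^ 2 := sq_sum_le_card_mul_sum_sq
  have hS : 0 ≤ ∑ j ∈ J, b j ^ 2 := Finset.sum_nonneg fun _ _ => sq_nonneg _
  have h9 : (9 : ℝ) / 16 ≤ (2 * r / k + 2) * ∑ j ∈ J, b j ^ 2 := by
    nlinarith [mul_le_mul_of_nonneg_right hJcard hS]
  refine le_trans ?_ hsq
  have e : (k : ℝ) / (2 * r + 2 * k) = 1 / (2 * r / k + 2) := by field_simp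
  rw [e, mul_one_div, div_le_iff₀ hJpos]
  linarith

/-- The probability of the wrong majority, when the larger group consists of an independent copy
of the smaller group together with a remainder. -/
lemma prod_wrong_majority_le (β γ : Measure ℕ) [IsProbabilityMeasure β] [IsProbabilityMeasure γ]
    {δ : ℝ} (hδ : 0 ≤ δ) :
    ((β.prod β).prod γ).real {z | z.1.1 + z.2 < z.1.2} +
      (1 / 2 - δ) * ((β.prod β).prod γ).real {z | z.1.1 + z.2 = z.1.2} ≤
    1 / 2 - 1 / 2 * ((β.prod β).prod γ).real {z | |(z.1.1 : ℝ) - z.1.2| < z.2} -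
      δ * ((β.prod β).prod γ).real {z | z.1.1 = z.1.2 ∧ z.2 = 0} := by
  set π := (β.prod β).prod γ
  let f₁ : (ℕ × ℕ) × ℕ → ℝ := Set.indicator {z | z.1.1 + z.2 < z.1.2} 1
  let f₂ : (ℕ × ℕ) × ℕ → ℝ := Set.indicator {z | z.1.1 + z.2 = z.1.2} 1
  let f₃ : (ℕ × ℕ) × ℕ → ℝ := Set.indicator {z | |(z.1.1 : ℝ) - z.1.2| < z.2} 1
  let f₄ : (ℕ × ℕ) × ℕ → ℝ := Set.indicator {z | z.1.1 = z.1.2 ∧ z.2 = 0} 1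
  have hi : ∀ S : Set ((ℕ × ℕ) × ℕ), Integrable (Set.indicator S (1 : (ℕ × ℕ) × ℕ → ℝ)) π :=
    fun S => (integrable_const (1 : ℝ)).indicator MeasurableSet.of_discrete
  -- Collects the error and the claimed gains in one function. Swapping the two identically
  -- distributed counts preserves the law, and `φ z + φ (σ z) ≤ 1` pointwise, so the integral is at
  -- most 1/2.
  let φ : (ℕ × ℕ) × ℕ → ℝ := fun z => f₁ z + (1 / 2 - δ) * f₂ z + 1 / 2 * f₃ z + δ * f₄ z
  have i₁ : Integrable f₁ π := hi _
  have i₂ : Integrable (fun z => (1 / 2 - δ) * f₂ z) π := (hi _).const_mul _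
  have i₃ : Integrable (fun z => 1 / 2 * f₃ z) π := (hi _).const_mul _
  have i₄ : Integrable (fun z => δ * f₄ z) π := (hi _).const_mul _
  have i₁₂ : Integrable (fun z => f₁ z + (1 / 2 - δ) * f₂ z) π := i₁.add i₂
  have i₁₃ : Integrable (fun z => f₁ z + (1 / 2 - δ) * f₂ z + 1 / 2 * f₃ z) π := i₁₂.add i₃
  have hφi : Integrable φ π := i₁₃.add i₄
  have hφ : ∫ z, φ z ∂π = π.real {z | z.1.1 + z.2 < z.1.2} +
      (1 / 2 - δ) * π.real {z | z.1.1 + z.2 = z.1.2} +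
      1 / 2 * π.real {z | |(z.1.1 : ℝ) - z.1.2| < z.2} +
      δ * π.real {z | z.1.1 = z.1.2 ∧ z.2 = 0} := by
    simp only [φ]
    rw [integral_add i₁₃ i₄, integral_add i₁₂ i₃, integral_add i₁ i₂, integral_const_mul,
      integral_const_mul, integral_const_mul, integral_indicator_one .of_discrete, integral_indicator_one .of_discrete,
      integral_indicator_one .of_discrete, integral_indicator_one .of_discrete]
  let σ : (ℕ × ℕ) × ℕ → (ℕ × ℕ) × ℕ := Prod.map Prod.swap id
  have hσ : MeasurePreserving σ π π :=
    (Measure.measurePreserving_swap (μ := β) (ν := β)).prod (MeasurePreserving.id γ)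
  have hswap : ∫ z, φ (σ z) ∂π = ∫ z, φ z ∂π := by
    rw [← integral_map (φ := σ) (f := φ) hσ.measurable.aemeasurable (by fun_prop), hσ.map_eq]
  have hpt : ∀ z, φ z + φ (σ z) ≤ 1 := by
    rintro ⟨⟨a, b⟩, w⟩
    have h3 : ∀ a b : ℕ, |(a : ℝ) - b| < w ↔ (a < b + w ∧ b < a + w) := by
      intro a b
      rw [abs_lt]
      constructor
      · rintro ⟨h1, h2⟩
        constructor
        · have : (a : ℝ) < b + w := by linarith
          exact_mod_cast this
        · have : (b : ℝ) < a + w := by linarith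
          exact_mod_cast this
      · rintro ⟨h1, h2⟩
        have h1' : (a : ℝ) < b + w := by exact_mod_cast h1
        have h2' : (b : ℝ) < a + w := by exact_mod_cast h2
        constructor <;> linarith
    simp only [φ, f₁, f₂, f₃, f₄, σ, Prod.map, Prod.swap, id, Set.indicator_apply,
      Set.mem_ofPred_eq, h3, Pi.one_apply]
    split_ifs <;> first | omega | linarith
  have hφσ : Integrable (fun z => φ (σ z)) π := hσ.integrable_comp_of_integrable hφi
  have h2 : ∫ z, (φ z + φ (σ z)) ∂π ≤ 1 := by
    refine (integral_mono (hφi.add hφσ)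
      (integrable_const (1 : ℝ)) hpt).trans ?_
    simp
  rw [integral_add hφi hφσ, hswap, hφ] at h2
  linarith

variable {ι : Type*} [Fintype ι] [DecidableEq ι]

lemma coins_forall_false (p : unitInterval) (S : Finset ι) :
    (coins ι p).real {x | ∀ i ∈ S, x i = false} = (1 - p) ^ S.card := by
  have h : {x : ι → Bool | ∀ i ∈ S, x i = false} = Set.pi S fun _ => {false} := by
    ext x; simp
  rw [h, measureReal_def, Measure.infinitePi_pi _ (fun _ _ => .of_discrete)]
  rw [ENNReal.toReal_prod]
  simp

lemma coins_concentration (p : unitInterval) (S : Finset ι) {r : ℝ} (hr : 0 < r)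
    (h : 4 * ((p : ℝ) * S.card) ≤ r ^ 2) :
    3 / 4 ≤ ((coins ι p).map (hits S)).real {y : ℕ | |(y : ℝ) - p * S.card| < r} := by
  have hcheb := meas_ge_le_variance_div_sq (μ := coins ι p) (X := fun x => (hits S x : ℝ))
    MemLp.of_discrete hr
  rw [integral_hits] at hcheb
  have h1 : (coins ι p).real {x | r ≤ |(hits S x : ℝ) - p * S.card|} ≤ 1 / 4 := by
    refine (ENNReal.toReal_le_of_le_ofReal (div_nonneg (variance_nonneg _ _) (sq_nonneg r))
      hcheb).trans ?_
    rw [div_le_iff₀ (by positivity)]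
    linarith [variance_hits_le p S]
  rw [map_measureReal_apply .of_discrete .of_discrete]
  have h2 := probReal_compl_eq_one_sub (μ := coins ι p)
    (s := {x | r ≤ |(hits S x : ℝ) - p * S.card|}) (Set.toFinite _).measurableSet
  have h3 : {x : ι → Bool | r ≤ |(hits S x : ℝ) - p * S.card|}ᶜ =
      hits S ⁻¹' {y : ℕ | |(y : ℝ) - p * S.card| < r} := by
    ext x; simp
  rw [h3] at h2
  linarith

/-- Averages `le_prod_dist_lt` over the random window `hits T`. The function w / (2r + 2w) is
replaced by a quadratic minorant, so that two moments suffice. -/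
lemma le_prod_dist_lt_hits (p : unitInterval) (S T : Finset ι) {r : ℝ} (hr : 0 < r)
    (h : 4 * ((p : ℝ) * S.card) ≤ r ^ 2) :
    9 / 16 * ((p : ℝ) * T.card / (2 * r + 2 + 2 * (p * T.card))) ≤
      ((((coins ι p).map (hits S)).prod ((coins ι p).map (hits S))).prod
        ((coins ι p).map (hits T))).real {z | |(z.1.1 : ℝ) - z.1.2| < z.2} := by
  have hp0 : (0 : ℝ) ≤ p := p.2.1
  set β := (coins ι p).map (hits S)
  set γ := (coins ι p).map (hits T) with hγ
  have hβ : IsProbabilityMeasure β :=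
    Measure.isProbabilityMeasure_map Measurable.of_discrete.aemeasurable
  have hγp : IsProbabilityMeasure γ :=
    Measure.isProbabilityMeasure_map Measurable.of_discrete.aemeasurable
  have hintegral : ((β.prod β).prod γ).real {z | |(z.1.1 : ℝ) - z.1.2| < z.2} =
      ∫ w, (β.prod β).real {z | |(z.1 : ℝ) - z.2| < w} ∂γ := by
    have hi : Integrable (Set.indicator {z : (ℕ × ℕ) × ℕ | |(z.1.1 : ℝ) - z.1.2| < z.2} 1)
      ((β.prod β).prod γ) := (integrable_const (1 : ℝ)).indicator .of_discrete
    rw [← integral_indicator_one .of_discrete, integral_prod_symm _ hi]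
    refine integral_congr_ae (.of_forall fun w => ?_)
    simp only
    rw [← integral_indicator_one .of_discrete]
    rfl
  rw [hintegral, hγ, integral_map Measurable.of_discrete.aemeasurable
    Measurable.of_discrete.aestronglyMeasurable]
  set μ : ℝ := p * T.card with hμ
  have hμ0 : 0 ≤ μ := by positivity
  -- The minorant comes from 1/x ≥ 2l - l²x. This tangent point makes the second moment bound μ + μ²
  -- collapse to exactly l μ.
  set l : ℝ := 1 / (2 * r + 2 + 2 * μ) with hl
  have hlower : ∀ x : ι → Bool,
      9 / 16 * (2 * l * hits T x - l ^ 2 * (2 * r * hits T x + 2 * (hits T x : ℝ) ^ 2)) ≤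
        (β.prod β).real {z | |(z.1 : ℝ) - z.2| < hits T x} := by
    intro x
    rcases Nat.eq_zero_or_pos (hits T x) with h0 | hpos
    · simp [h0]
    · refine le_trans ?_ (le_prod_dist_lt β (m := p * S.card) (by positivity) hr.le
        (coins_concentration p S hr h) hpos)
      have hw : (0 : ℝ) < hits T x := by exact_mod_cast hpos
      gcongr
      rw [le_div_iff₀ (by positivity)]
      nlinarith [mul_nonneg hw.le (sq_nonneg (1 - l * (2 * r + 2 * hits T x)))]
  refine le_trans ?_ (integral_mono Integrable.of_finite Integrable.of_finite hlower)
  rw [integral_const_mul, integral_sub Integrable.of_finite Integrable.of_finite,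
    integral_const_mul, integral_const_mul, integral_add Integrable.of_finite Integrable.of_finite,
    integral_const_mul, integral_const_mul, integral_hits]
  have hsq := integral_hits_sq_le p T
  rw [← hμ] at hsq ⊢
  have hl0 : 0 < l := by positivity
  have hll : l * (2 * r + 2 + 2 * μ) = 1 := by rw [hl]; field_simp
  gcongr
  have e : μ / (2 * r + 2 + 2 * μ) = l * μ := by rw [hl]; ring
  rw [e]
  have : l ^ 2 * (2 * r * μ + 2 * ∫ x, (hits T x : ℝ) ^ 2 ∂(coins ι p)) ≤
      l ^ 2 * (2 * r * μ + 2 * (μ + μ ^ 2)) := by gcongr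
  have e2 : l ^ 2 * (2 * r * μ + 2 * (μ + μ ^ 2)) = l * (l * (2 * r + 2 + 2 * μ)) * μ := by ring
  rw [e2, hll] at this
  linarith

/-- A constant drift towards the correct opinion that sustains itself. -/
noncomputable def drift (δ : ℝ) : ℝ := min (1 / 100) (δ * Real.exp (-800))

lemma drift_pos {δ : ℝ} (hδ : 0 < δ) : 0 < drift δ := by
  unfold drift; positivity

lemma drift_le (δ : ℝ) : drift δ ≤ 1 / 100 := min_le_left _ _

lemma drift_le_half {δ : ℝ} (hδ : 0 < δ) : drift δ ≤ δ / 2 := by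
  refine (min_le_right _ _).trans ?_
  have h : Real.exp (-800) ≤ 1 / 2 := by
    rw [Real.exp_neg, one_div]
    gcongr
    linarith [Real.add_one_le_exp (800 : ℝ)]
  nlinarith

/-- Let τ be the expected number of visible announcements. If τ ≤ 400, no announcement is visible
with probability at least exp(-800), and then the belief supplies an advantage δ. If τ ≥ 400, the
surplus of the larger group has mean at least `drift δ * τ`, while the fluctuations are of order √τ;
the surplus decides often enough to gain `drift δ`. -/
lemma coins_wrong_majority_le (p : unitInterval) (hp : (p : ℝ) ≤ 1 / 2) {δ : ℝ} (hδ : 0 < δ)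
    {A B : Finset ι} (hAB : Disjoint A B)
    (h : drift δ * (A.card + B.card) ≤ (A.card : ℝ) - B.card) :
    (coins ι p).real {x | hits A x < hits B x} +
      (1 / 2 - δ) * (coins ι p).real {x | hits A x = hits B x} ≤ 1 / 2 - drift δ := by
  have hε := drift_pos hδ
  have hp0 : (0 : ℝ) ≤ p := p.2.1
  have hcard : B.card ≤ A.card := by
    have : (0 : ℝ) ≤ A.card - B.card := le_trans (by positivity) h
    exact_mod_cast sub_nonneg.1 this
  obtain ⟨S, hSA, hS⟩ := Finset.exists_subset_card_eq hcard
  set T := A \ S with hT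
  have hTc : (T.card : ℝ) = A.card - B.card := by
    rw [hT, Finset.card_sdiff_of_subset hSA, hS, Nat.cast_sub hcard]
  have hSB : Disjoint S B := Finset.disjoint_of_subset_left hSA hAB
  have hST : Disjoint S T := Finset.disjoint_sdiff
  have hSBT : Disjoint (S ∪ B) T := by
    rw [Finset.disjoint_union_left]
    exact ⟨hST, (Finset.disjoint_of_subset_left Finset.sdiff_subset hAB).symm⟩
  have hA : ∀ x : ι → Bool, hits A x = hits S x + hits T x := by
    intro x
    rw [← hits_union hST, hT, Finset.union_sdiff_of_subset hSA]
  have hmap := map_hits_triple p hSB hSBT hS.symm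
  have hβ : IsProbabilityMeasure ((coins ι p).map (hits S)) :=
    Measure.isProbabilityMeasure_map Measurable.of_discrete.aemeasurable
  have hγ : IsProbabilityMeasure ((coins ι p).map (hits T)) :=
    Measure.isProbabilityMeasure_map Measurable.of_discrete.aemeasurable
  have hmain := prod_wrong_majority_le ((coins ι p).map (hits S)) ((coins ι p).map (hits T)) hδ.le
  have hpull : ∀ U : Set ((ℕ × ℕ) × ℕ), ((((coins ι p).map (hits S)).prod
      ((coins ι p).map (hits S))).prod ((coins ι p).map (hits T))).real U =
      (coins ι p).real {x | ((hits S x, hits B x), hits T x) ∈ U} := by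
    intro U
    rw [← hmap, map_measureReal_apply .of_discrete .of_discrete]
    rfl
  -- Radius for Chebyshev's inequality with error 1/4, since the variance is at most p |S|; the
  -- added 1 keeps it positive.
  have hdist := le_prod_dist_lt_hits p S T (r := 2 * Real.sqrt (p * (A.card + B.card) + 1))
    (by positivity) (by
      rw [mul_pow, Real.sq_sqrt (by positivity), hS]
      nlinarith [mul_nonneg hp0 (Nat.cast_nonneg (α := ℝ) A.card)])
  have hzero : (1 - p : ℝ) ^ (A.card + B.card) ≤
      (coins ι p).real {x | ((hits S x, hits B x), hits T x) ∈
        {z : (ℕ × ℕ) × ℕ | z.1.1 = z.1.2 ∧ z.2 = 0}} := by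
    rw [← Finset.card_union_of_disjoint hAB, ← coins_forall_false]
    refine measureReal_mono ?_ (measure_ne_top _ _)
    intro x hx
    have hx0 : ∀ U ⊆ A ∪ B, hits U x = 0 := fun U hU =>
      Finset.sum_eq_zero fun i hi => by simp [hx i (hU hi)]
    simp only [Set.mem_ofPred_eq]
    rw [hx0 S (hSA.trans Finset.subset_union_left), hx0 B Finset.subset_union_right,
      hx0 T (Finset.sdiff_subset.trans Finset.subset_union_left)]
    simp
  have e1 : {x : ι → Bool | hits A x < hits B x} = {x | ((hits S x, hits B x), hits T x) ∈
      {z : (ℕ × ℕ) × ℕ | z.1.1 + z.2 < z.1.2}} := by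
    ext x; simp [hA]
  have e2 : {x : ι → Bool | hits A x = hits B x} = {x | ((hits S x, hits B x), hits T x) ∈
      {z : (ℕ × ℕ) × ℕ | z.1.1 + z.2 = z.1.2}} := by
    ext x; simp [hA]
  rw [e1, e2, ← hpull, ← hpull]
  refine hmain.trans ?_
  set m : ℝ := A.card + B.card with hm
  have hm0 : 0 ≤ m := by positivity
  rcases le_total (p * m) 400 with hsmall | hlarge
  · have h1 : δ * Real.exp (-800) ≤ δ * ((1 - p : ℝ) ^ (A.card + B.card)) := by
      gcongr
      have h2 : Real.exp (-(2 * p)) ≤ 1 - p := by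
        have hb := Real.add_one_le_exp (2 * (p : ℝ))
        rw [Real.exp_neg, inv_le_iff_one_le_mul₀ (by positivity)]
        nlinarith
      calc Real.exp (-800) ≤ Real.exp (-(2 * p) * ((A.card + B.card : ℕ) : ℝ)) := by
            rw [Real.exp_le_exp]; push_cast; rw [← hm]; linarith
        _ = Real.exp (-(2 * p)) ^ (A.card + B.card) := by
            rw [← Real.exp_nat_mul, mul_comm]
        _ ≤ _ := by gcongr
    have h3 : drift δ ≤ δ * Real.exp (-800) := min_le_right _ _
    have h4 : 0 ≤ (((((coins ι p).map (hits S)).prod ((coins ι p).map (hits S))).prod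
      ((coins ι p).map (hits T))).real {z | |(z.1.1 : ℝ) - z.1.2| < z.2}) := measureReal_nonneg
    rw [← hpull] at hzero
    have h5 := mul_le_mul_of_nonneg_left hzero hδ.le
    linarith
  · set τ : ℝ := p * m with hτ
    have hμ : drift δ * τ ≤ p * T.card := by
      rw [hTc, hτ]
      nlinarith [mul_le_mul_of_nonneg_left h hp0]
    set μ : ℝ := p * T.card with hμdef
    -- Here τ ≥ 400 enters: the noise is a small multiple of τ, and after multiplication by the
    -- drift it is a small multiple of μ.
    have hs : Real.sqrt (τ + 1) ≤ τ / 19 := by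
      rw [Real.sqrt_le_iff]
      constructor
      · positivity
      · nlinarith
    have h6 : 2 * drift δ ≤ 9 / 16 * (μ / (2 * (2 * Real.sqrt (τ + 1)) + 2 + 2 * μ)) := by
      have hμ0 : 0 ≤ μ := by positivity
      have hd := drift_le δ
      rw [← mul_div_assoc, le_div_iff₀ (by positivity)]
      have : 2 * drift δ * (2 * (2 * Real.sqrt (τ + 1)) + 2 + 2 * μ) ≤
          2 * drift δ * (2 * (2 * (τ / 19)) + τ / 200) + 4 / 100 * μ := by
        nlinarith [mul_le_mul_of_nonneg_left hs hε.le, mul_le_mul_of_nonneg_right hd hμ0]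
      nlinarith
    have h7 : 0 ≤ δ * (((((coins ι p).map (hits S)).prod ((coins ι p).map (hits S))).prod
      ((coins ι p).map (hits T))).real {z | z.1.1 = z.1.2 ∧ z.2 = 0}) :=
      mul_nonneg hδ.le measureReal_nonneg
    linarith [hdist]

end Drift

/-! ### Coins for edges and beliefs, and deferred decisions -/

section Exposure

variable {V : Type*} [Fintype V] [DecidableEq V]

/-- The joint law of independent coins, one for each potential edge and one for each belief. -/
noncomputable abbrev seedLaw (V : Type*) (p q : unitInterval) : Measure (Sym2 V ⊕ V → Bool) :=
  Measure.infinitePi fun i =>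
    bernoulliMeasure true false (Sum.elim (fun _ => p) (fun _ => q) i)

/-- The graph whose edges are the pairs with a successful coin. -/
def graphOf (ω : Sym2 V ⊕ V → Bool) : SimpleGraph V :=
  SimpleGraph.fromEdgeSet {e | ω (Sum.inl e) = true}

/-- The private beliefs read off from the coins. -/
def beliefOf (ω : Sym2 V ⊕ V → Bool) (v : V) : Bool := ω (Sum.inr v)

/-- The nodes that currently announce `o`. -/
def announcing (C : V → Opinion) (o : Opinion) : Finset V := {v | C v = o}

/-- The nodes that have announced something. -/
def announced (C : V → Opinion) : Finset V := {v | C v ≠ none}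

/-- The number of correct minus the number of incorrect announcements. -/
def bias (C : V → Opinion) : ℤ := ∑ v, score (C v)

lemma disjoint_announcing (C : V → Opinion) :
    Disjoint (announcing C (some true)) (announcing C (some false)) := by
  rw [Finset.disjoint_left]
  intro v h1 h2
  simp only [announcing, Finset.mem_filter, Finset.mem_univ, true_and] at h1 h2
  simp [h1] at h2

lemma announcing_union (C : V → Opinion) :
    announcing C (some true) ∪ announcing C (some false) = announced C := by
  ext v
  simp only [announcing, announced, Finset.mem_union, Finset.mem_filter, Finset.mem_univ, true_and]
  rcases C v with _ | _ | _ <;> simp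

lemma card_announcing_add (C : V → Opinion) :
    (announcing C (some true)).card + (announcing C (some false)).card = (announced C).card := by
  rw [← announcing_union, Finset.card_union_of_disjoint (disjoint_announcing C)]

lemma bias_eq (C : V → Opinion) :
    bias C = (announcing C (some true)).card - (announcing C (some false)).card := by
  simp only [bias, announcing, Finset.card_filter, Nat.cast_sum, ← Finset.sum_sub_distrib]
  refine Finset.sum_congr rfl fun v _ => ?_
  rcases C v with _ | _ | _ <;> simp [score]

lemma bias_update (C : V → Opinion) (v : V) (o : Opinion) :
    bias (Function.update C v o) = bias C - score (C v) + score o := by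
  simp only [bias]
  rw [← Finset.add_sum_erase _ _ (Finset.mem_univ v),
    ← Finset.add_sum_erase _ (fun v => score (C v)) (Finset.mem_univ v), Function.update_self]
  have : ∑ x ∈ Finset.univ.erase v, score (Function.update C v o x) =
      ∑ x ∈ Finset.univ.erase v, score (C x) :=
    Finset.sum_congr rfl fun x hx => by rw [Function.update_of_ne (Finset.ne_of_mem_erase hx)]
  rw [this]
  ring

lemma margin_graphOf (ω : Sym2 V ⊕ V → Bool) (C : V → Opinion) (v : V) :
    margin (graphOf ω) C v =
      hits ((announcing C (some true)).erase v) (fun w => ω (Sum.inl s(v, w))) -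
        hits ((announcing C (some false)).erase v) (fun w => ω (Sum.inl s(v, w))) := by
  have h : ∀ S : Finset V, (hits S (fun w => ω (Sum.inl s(v, w))) : ℤ) =
      ∑ w, if w ∈ S then ((ω (Sum.inl s(v, w))).toNat : ℤ) else 0 := by
    intro S; simp [hits]
  rw [h, h, ← Finset.sum_sub_distrib, margin]
  refine Finset.sum_congr rfl fun w _ => ?_
  simp only [graphOf, SimpleGraph.fromEdgeSet_adj, Set.mem_ofPred_eq, announcing, Finset.mem_erase,
    Finset.mem_filter, Finset.mem_univ, true_and]
  by_cases hvw : w = v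
  · subst hvw; simp
  · have hvw' : v ≠ w := Ne.symm hvw
    rcases hC : C w with _ | _ | _ <;> cases hω : ω (Sum.inl s(v, w)) <;> simp [score, hvw, hvw']

lemma map_edges_at (p q : unitInterval) (v : V) :
    (seedLaw V p q).map (fun ω w => ω (Sum.inl s(v, w))) = coins V p := by
  have hinj : Function.Injective (fun w : V => (Sum.inl s(v, w) : Sym2 V ⊕ V)) := by
    intro a b hab
    have : a = b ∨ v = b ∧ a = v := by simpa using hab
    rcases this with h | ⟨h, h'⟩
    exacts [h, h'.trans h]
  exact Measure.map_infinitePi_infinitePi_of_inj (P := fun i : Sym2 V ⊕ V =>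
    bernoulliMeasure true false (Sum.elim (fun _ => p) (fun _ => q) i)) hinj

lemma seedLaw_edges_at (p q : unitInterval) (v : V) (U : Set (V → Bool)) :
    (seedLaw V p q).real {ω | (fun w => ω (Sum.inl s(v, w))) ∈ U} = (coins V p).real U := by
  rw [← map_edges_at p q v, map_measureReal_apply (by fun_prop) (Set.toFinite _).measurableSet]
  rfl

lemma seedLaw_belief_false (p q : unitInterval) (v : V) :
    (seedLaw V p q).real {ω | ω (Sum.inr v) = false} = 1 - q := by
  have h : {ω : Sym2 V ⊕ V → Bool | ω (Sum.inr v) = false} =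
      Set.pi (({Sum.inr v} : Finset (Sym2 V ⊕ V)) : Set (Sym2 V ⊕ V)) fun _ => {false} := by
    ext x; simp
  rw [h, measureReal_def, Measure.infinitePi_pi _ (fun _ _ => .of_discrete)]
  simp

/-- The edges at `v` and its belief use disjoint coins, so a tie costs an independent factor 1 - q.
As `v` is silent, it belongs to neither group. -/
lemma seedLaw_response_false_le (p q : unitInterval) {C : V → Opinion} {v : V} (hv : C v = none) :
    (seedLaw V p q).real {ω | response (graphOf ω) (beliefOf ω) C v = false} ≤
      (coins V p).real {x | hits (announcing C (some true)) x < hits (announcing C (some false)) x}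
      + (1 - q) * (coins V p).real
        {x | hits (announcing C (some true)) x = hits (announcing C (some false)) x} := by
  set A := announcing C (some true)
  set B := announcing C (some false)
  have hA : A.erase v = A := Finset.erase_eq_of_notMem (by simp [A, announcing, hv])
  have hB : B.erase v = B := Finset.erase_eq_of_notMem (by simp [B, announcing, hv])
  set e : (Sym2 V ⊕ V → Bool) → V → Bool := fun ω w => ω (Sum.inl s(v, w)) with he
  have hmargin : ∀ ω, margin (graphOf ω) C v = hits A (e ω) - hits B (e ω) := by
    intro ω
    rw [margin_graphOf, hA, hB]
  have hsub : {ω | response (graphOf ω) (beliefOf ω) C v = false} ⊆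
      {ω | e ω ∈ {x | hits A x < hits B x}} ∪
      {ω | hits A (e ω) = hits B (e ω) ∧ ω (Sum.inr v) = false} := by
    intro ω hω
    simp only [Set.mem_ofPred_eq, response_eq, hmargin, beliefOf] at hω
    simp only [Set.mem_union, Set.mem_ofPred_eq]
    split_ifs at hω with h1 h2
    · left; omega
    · right; exact ⟨by omega, hω⟩
  refine (measureReal_mono hsub (measure_ne_top _ _)).trans
    ((measureReal_union_le _ _).trans ?_)
  rw [seedLaw_edges_at]
  gcongr
  rw [infinitePi_inter_of_dependsOn
    (fun i => bernoulliMeasure true false (Sum.elim (fun _ => p) (fun _ => q) i))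
    (S := Finset.univ.image fun w => Sum.inl s(v, w))
    (T := {Sum.inr v})]
  · rw [seedLaw_belief_false, mul_comm]
    exact le_of_eq (congrArg _ (seedLaw_edges_at p q v {x | hits A x = hits B x}))
  · simp
  · intro ω ω' h
    have : e ω = e ω' := by
      funext w
      exact h _ (by simp)
    simp only [this]
  · intro ω ω' h
    have := h (Sum.inr v) (by simp)
    simp only [this]

/-- A node selected for the first time is more likely than not to announce the correct opinion. -/
lemma response_false_le_half_sub {p q : unitInterval} (hp : (p : ℝ) ≤ 1 / 2) {δ : ℝ} (hδ : 0 < δ)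
    (hδ' : δ < 1 / 2) (hq : (q : ℝ) = 1 / 2 + δ) {C : V → Opinion} {v : V} (hv : C v = none)
    (h : (p : ℝ) * (announced C).card ≤ δ / 2 ∨ drift δ * (announced C).card ≤ bias C) :
    (seedLaw V p q).real {ω | response (graphOf ω) (beliefOf ω) C v = false} ≤
      1 / 2 - drift δ := by
  refine (seedLaw_response_false_le p q hv).trans ?_
  have hq' : (1 - q : ℝ) = 1 / 2 - δ := by rw [hq]; ring
  rw [hq']
  set A := announcing C (some true) with hA
  set B := announcing C (some false) with hB
  have hAB : Disjoint A B := disjoint_announcing C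
  have hcard := card_announcing_add C
  rw [← hA, ← hB] at hcard
  rcases h with h | h
  -- A strict wrong majority needs an announced neighbour, which by Bernoulli's inequality has
  -- probability at most δ/2. Half of the belief's advantage remains.
  · have h1 : (coins V p).real {x | hits A x < hits B x} ≤ p * (announced C).card := by
      have h2 := coins_forall_false p (announced C)
      have h3 := probReal_compl_eq_one_sub (μ := coins V p)
        (s := {x | ∀ i ∈ announced C, x i = false}) (Set.toFinite _).measurableSet
      have h4 := one_add_mul_le_pow (a := (-p : ℝ)) (by linarith [p.2.2]) (announced C).card
      have h5 : {x | hits A x < hits B x} ⊆ {x | ∀ i ∈ announced C, x i = false}ᶜ := by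
        intro x hx hx'
        have : hits B x = 0 := Finset.sum_eq_zero fun i hi => by
          rw [hx' i (by rw [← announcing_union]; exact Finset.mem_union_right _ hi)]; rfl
        simp only [Set.mem_ofPred_eq] at hx
        omega
      refine (measureReal_mono h5 (measure_ne_top _ _)).trans ?_
      rw [h3, h2]
      have : (1 + -p : ℝ) = 1 - p := by ring
      rw [this] at h4
      linarith
    have h2 : (coins V p).real {x | hits A x = hits B x} ≤ 1 := measureReal_le_one
    have h3 := drift_le_half hδ
    nlinarith
  · refine coins_wrong_majority_le p hp hδ hAB ?_
    rw [bias_eq] at h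
    have : (A.card : ℝ) + B.card = (announced C).card := by exact_mod_cast hcard
    rw [this]
    refine h.trans (le_of_eq ?_)
    push_cast
    rfl

/-- Ties are counted as errors, so the belief is irrelevant. Strong once p times the number of
announcements is a large multiple of log n. -/
lemma response_false_le_exp {p q : unitInterval} {ε : ℝ} (hε : 0 ≤ ε) {C : V → Opinion} {v : V}
    (hv : C v = none) (h : ε * (announced C).card ≤ bias C) :
    (seedLaw V p q).real {ω | response (graphOf ω) (beliefOf ω) C v = false} ≤
      Real.exp (-(p * ε ^ 2 * (announced C).card / 4)) := by
  set A := announcing C (some true) with hA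
  set B := announcing C (some false) with hB
  have hAB : Disjoint A B := disjoint_announcing C
  have hcard := card_announcing_add C
  rw [← hA, ← hB] at hcard
  have hcard' : (A.card : ℝ) + B.card = (announced C).card := by exact_mod_cast hcard
  have hbound := coins_hits_le_hits p hε hAB (by
    rw [hcard']
    rw [bias_eq] at h
    refine h.trans (le_of_eq ?_)
    push_cast
    rfl)
  rw [hcard'] at hbound
  refine le_trans ?_ hbound
  rw [← seedLaw_edges_at p q v]
  refine measureReal_mono ?_ (measure_ne_top _ _)
  intro ω hω
  have hA' : A.erase v = A := Finset.erase_eq_of_notMem (by simp [A, announcing, hv])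
  have hB' : B.erase v = B := Finset.erase_eq_of_notMem (by simp [B, announcing, hv])
  simp only [Set.mem_ofPred_eq, response_eq, margin_graphOf] at hω ⊢
  rw [← hA, ← hB, hA', hB'] at hω
  by_contra hlt
  rw [if_pos (by omega)] at hω
  simp at hω

/-- The nodes selected in the first `t` rounds. -/
def visited (s : ℕ → V) (t : ℕ) : Finset V := (Finset.range t).image s

/-- The number of selections among the first `t` that repeat an earlier one. -/
def repeats (s : ℕ → V) (t : ℕ) : ℕ := ((Finset.range t).filter fun i => s i ∈ visited s i).card

lemma visited_succ (s : ℕ → V) (t : ℕ) : visited s (t + 1) = insert (s t) (visited s t) := by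
  simp [visited, Finset.range_add_one, Finset.image_insert]

lemma mem_visited {s : ℕ → V} {t : ℕ} {v : V} : v ∈ visited s t ↔ ∃ i < t, s i = v := by
  simp [visited]

lemma repeats_succ (s : ℕ → V) (t : ℕ) :
    repeats s (t + 1) = repeats s t + if s t ∈ visited s t then 1 else 0 := by
  simp only [repeats, Finset.card_filter, Finset.sum_range_succ]

lemma card_visited_add_repeats (s : ℕ → V) (t : ℕ) : (visited s t).card + repeats s t = t := by
  induction t with
  | zero => simp [visited, repeats]
  | succ t ih =>
    rw [visited_succ, repeats_succ]
    split_ifs with h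
    · rw [Finset.insert_eq_of_mem h]; omega
    · rw [Finset.card_insert_of_notMem h]; omega

/-- The pessimistic process driven by the coins `ω`. -/
noncomputable abbrev lowOf (s : ℕ → V) (t : ℕ) (ω : Sym2 V ⊕ V → Bool) : V → Opinion :=
  low (graphOf ω) (beliefOf ω) s t

lemma announced_lowOf (s : ℕ → V) (t : ℕ) (ω : Sym2 V ⊕ V → Bool) :
    announced (lowOf s t ω) = visited s t := by
  ext v
  simp only [announced, Finset.mem_filter, Finset.mem_univ, true_and, ne_eq, low_eq_none_iff,
    mem_visited]
  push Not
  rfl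

/-- The coins for the pairs within `A` and for the beliefs of the nodes in `A`. -/
def coinsWithin (A : Finset V) : Finset (Sym2 V ⊕ V) :=
  A.sym2.map ⟨Sum.inl, Sum.inl_injective⟩ ∪ A.map ⟨Sum.inr, Sum.inr_injective⟩

/-- The coins that determine the response of `v` when the nodes in `A` have announced. -/
def coinsAt (A : Finset V) (v : V) : Finset (Sym2 V ⊕ V) :=
  insert (Sum.inr v) (A.image fun w => Sum.inl s(v, w))

/-- Pairs containing `v` are not pairs within `A`: the history among `A` carries no information on
the response of a fresh node. -/
lemma disjoint_coinsWithin_coinsAt {A : Finset V} {v : V} (hv : v ∉ A) :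
    Disjoint (coinsWithin A) (coinsAt A v) := by
  rw [Finset.disjoint_left]
  rintro (e | a) h1 h2
  · simp [coinsWithin, coinsAt] at h1 h2
    obtain ⟨w, hw, rfl⟩ := h2
    simp at h1
    exact hv h1.1
  · simp [coinsWithin, coinsAt] at h1 h2
    exact hv (h2 ▸ h1)

lemma coinsWithin_mono {A B : Finset V} (h : A ⊆ B) : coinsWithin A ⊆ coinsWithin B := by
  rintro (e | a) h1
  · simp [coinsWithin] at h1 ⊢
    exact fun a ha => h (h1 a ha)
  · simp [coinsWithin] at h1 ⊢
    exact h h1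

lemma coinsAt_subset {A : Finset V} {v : V} : coinsAt A v ⊆ coinsWithin (insert v A) := by
  rintro (e | a) h1
  · simp [coinsAt] at h1
    obtain ⟨w, hw, rfl⟩ := h1
    simp [coinsWithin, hw]
  · simp [coinsAt] at h1
    simp [coinsWithin, h1]

lemma dependsOn_response (C : V → Opinion) (v : V) :
    DependsOn (fun ω : Sym2 V ⊕ V → Bool => response (graphOf ω) (beliefOf ω) C v)
      (coinsAt (announced C) v : Set (Sym2 V ⊕ V)) := by
  intro ω ω' h
  have hb : beliefOf ω v = beliefOf ω' v := h (Sum.inr v) (by simp [coinsAt])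
  have hm : margin (graphOf ω) C v = margin (graphOf ω') C v := by
    simp only [margin_graphOf, hits]
    have hsum : ∀ o, o ≠ none → ∑ i ∈ (announcing C o).erase v, (ω (Sum.inl s(v, i))).toNat =
        ∑ i ∈ (announcing C o).erase v, (ω' (Sum.inl s(v, i))).toNat := by
      intro o ho
      refine Finset.sum_congr rfl fun w hw => ?_
      rw [h (Sum.inl s(v, w)) ?_]
      have : w ∈ announced C := by
        simp only [announcing, Finset.mem_erase, Finset.mem_filter, Finset.mem_univ,
          true_and] at hw
        simp [announced, hw.2, ho]
      simp only [coinsAt, Finset.coe_insert, Finset.coe_image, Set.mem_insert_iff, reduceCtorEq,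
        Set.mem_image, false_or]
      exact ⟨w, this, rfl⟩
    rw [hsum _ (by simp), hsum _ (by simp)]
  simp only [response_eq, hb, hm]

lemma dependsOn_lowOf (s : ℕ → V) (t : ℕ) :
    DependsOn (lowOf s t) (coinsWithin (visited s t) : Set (Sym2 V ⊕ V)) := by
  induction t with
  | zero => intro ω ω' _; rfl
  | succ t ih =>
    intro ω ω' h
    rw [visited_succ] at h
    have h1 : lowOf s t ω = lowOf s t ω' :=
      ih fun i hi => h i (coinsWithin_mono (Finset.subset_insert _ _) hi)
    have h2 : response (graphOf ω) (beliefOf ω) (lowOf s t ω') (s t) =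
        response (graphOf ω') (beliefOf ω') (lowOf s t ω') (s t) :=
      dependsOn_response _ _ fun i hi => h i (coinsAt_subset (by
        rw [announced_lowOf] at hi
        exact hi))
    simp only [lowOf] at h1 h2
    simp only [lowOf, low, h1, h2]

end Exposure

/-! ### An exponential supermartingale for the bias -/

section FixedSelection

open scoped Classical in
/-- Conditioning on the value of `L`: a bound for the conditional probabilities of the events
`F C` given `L = C` carries over to weighted averages. -/
lemma integral_ite_le_of_conditional {Ω σ : Type*} [Finite Ω] [MeasurableSpace Ω]
    [MeasurableSingletonClass Ω] [Fintype σ] (μ : Measure Ω) [IsProbabilityMeasure μ]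
    (E : Ω → Prop) (L : Ω → σ) (F : σ → Ω → Prop) {c : ℝ}
    (h : ∀ C, μ.real {ω | (E ω ∧ L ω = C) ∧ F C ω} ≤ c * μ.real {ω | E ω ∧ L ω = C})
    {w : σ → ℝ} (hw : ∀ C, 0 ≤ w C) :
    ∫ ω, (if E ω ∧ F (L ω) ω then w (L ω) else 0) ∂μ ≤
      c * ∫ ω, (if E ω then w (L ω) else 0) ∂μ := by
  have hm : ∀ S : Set Ω, MeasurableSet S := fun S => (Set.toFinite S).measurableSet
  have h1 : ∀ ω, (if E ω ∧ F (L ω) ω then w (L ω) else 0) =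
      ∑ C, w C * Set.indicator {ω | (E ω ∧ L ω = C) ∧ F C ω} 1 ω := by
    intro ω
    rw [Finset.sum_eq_single (L ω)]
    · simp [Set.indicator_apply]
    · intro C _ hC
      rw [Set.indicator_of_notMem, mul_zero]
      rintro ⟨⟨-, h⟩, -⟩
      exact hC h.symm
    · simp
  have h2 : ∀ ω, (if E ω then w (L ω) else 0) =
      ∑ C, w C * Set.indicator {ω | E ω ∧ L ω = C} 1 ω := by
    intro ω
    rw [Finset.sum_eq_single (L ω)]
    · simp [Set.indicator_apply]
    · intro C _ hC
      rw [Set.indicator_of_notMem, mul_zero]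
      rintro ⟨-, h⟩
      exact hC h.symm
    · simp
  simp only [h1, h2]
  rw [integral_finsetSum _ fun _ _ => Integrable.of_finite,
    integral_finsetSum _ fun _ _ => Integrable.of_finite, Finset.mul_sum]
  refine Finset.sum_le_sum fun C _ => ?_
  rw [integral_const_mul, integral_const_mul, integral_indicator_one (hm _),
    integral_indicator_one (hm _)]
  have := mul_le_mul_of_nonneg_left (h C) (hw C)
  linarith

variable {V : Type*} [Fintype V] [DecidableEq V]

/-- From round `t₀` on and before round `t`, the bias of the pessimistic process has been at least
`ε` times the number of rounds. -/
def BiasedUntil (ε : ℝ) (t₀ : ℕ) (s : ℕ → V) (t : ℕ) (ω : Sym2 V ⊕ V → Bool) : Prop :=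
  ∀ r < t, t₀ ≤ r → ε * r ≤ bias (lowOf s r ω)

lemma visited_mono (s : ℕ → V) {r t : ℕ} (h : r ≤ t) : visited s r ⊆ visited s t :=
  Finset.image_subset_image (by simpa using h)

lemma dependsOn_biasedUntil (ε : ℝ) (t₀ : ℕ) (s : ℕ → V) (t : ℕ) :
    DependsOn (BiasedUntil ε t₀ s (t + 1)) (coinsWithin (visited s t) : Set (Sym2 V ⊕ V)) := by
  intro ω ω' h
  have : ∀ r < t + 1, lowOf s r ω = lowOf s r ω' := fun r hr =>
    dependsOn_lowOf s r fun i hi => h i (coinsWithin_mono (visited_mono s (by omega)) hi)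
  refine propext (forall_congr' fun r => forall_congr' fun hr => ?_)
  rw [this r hr]

/-- History and fresh response depend on disjoint coins, so the joint probability factorises. A
state `C` incompatible with the history gives an empty event, which is why `hresp` is needed for
compatible states only. -/
lemma seedLaw_biased_response_le {p q : unitInterval} {ε c : ℝ} (hc : 0 ≤ c) {t₀ t : ℕ} {s : ℕ → V}
    (hfresh : s t ∉ visited s t)
    (hresp : ∀ C : V → Opinion, announced C = visited s t → (t₀ ≤ t → ε * t ≤ bias C) →
      (seedLaw V p q).real {ω | response (graphOf ω) (beliefOf ω) C (s t) = false} ≤ c)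
    (C : V → Opinion) :
    (seedLaw V p q).real {ω | (BiasedUntil ε t₀ s (t + 1) ω ∧ lowOf s t ω = C) ∧
        response (graphOf ω) (beliefOf ω) C (s t) = false} ≤
      c * (seedLaw V p q).real {ω | BiasedUntil ε t₀ s (t + 1) ω ∧ lowOf s t ω = C} := by
  by_cases hne : ∃ ω, BiasedUntil ε t₀ s (t + 1) ω ∧ lowOf s t ω = C
  · obtain ⟨ω₀, hb, hC⟩ := hne
    have hann : announced C = visited s t := by rw [← hC, announced_lowOf]
    have hbias : t₀ ≤ t → ε * t ≤ bias C := fun h => hC ▸ hb t (by omega) h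
    rw [infinitePi_inter_of_dependsOn
      (fun i => bernoulliMeasure true false (Sum.elim (fun _ => p) (fun _ => q) i))
      (S := coinsWithin (visited s t)) (T := coinsAt (visited s t) (s t))
      (disjoint_coinsWithin_coinsAt hfresh)
      (E := fun ω => BiasedUntil ε t₀ s (t + 1) ω ∧ lowOf s t ω = C)
      (F := fun ω => response (graphOf ω) (beliefOf ω) C (s t) = false), mul_comm]
    · exact mul_le_mul_of_nonneg_right (hresp C hann hbias) measureReal_nonneg
    · intro ω ω' h
      simp only
      rw [dependsOn_biasedUntil ε t₀ s t h, dependsOn_lowOf s t h]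
    · intro ω ω' h
      rw [← hann] at h
      have := dependsOn_response C (s t) h
      simp only at this ⊢
      rw [this]
  · have : {ω | (BiasedUntil ε t₀ s (t + 1) ω ∧ lowOf s t ω = C) ∧
        response (graphOf ω) (beliefOf ω) C (s t) = false} = ∅ := by
      ext ω
      simp only [Set.mem_ofPred_eq, Set.mem_empty_iff_false, iff_false]
      exact fun h => hne ⟨ω, h.1⟩
    rw [this, measureReal_empty]
    exact mul_nonneg hc measureReal_nonneg

lemma lowOf_succ_of_fresh {s : ℕ → V} {t : ℕ} (h : s t ∉ visited s t) (ω : Sym2 V ⊕ V → Bool) :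
    lowOf s t ω (s t) = none ∧ lowOf s (t + 1) ω = Function.update (lowOf s t ω) (s t)
      (some (response (graphOf ω) (beliefOf ω) (lowOf s t ω) (s t))) := by
  have h1 : lowOf s t ω (s t) = none :=
    (low_eq_none_iff _ _ _ _ _).2 fun i hi hs => h (mem_visited.2 ⟨i, hi, hs⟩)
  refine ⟨h1, ?_⟩
  simp only [lowOf, low] at h1 ⊢
  rw [if_pos h1]

lemma bias_lowOf_succ_of_fresh {s : ℕ → V} {t : ℕ} (h : s t ∉ visited s t)
    (ω : Sym2 V ⊕ V → Bool) :
    bias (lowOf s (t + 1) ω) = bias (lowOf s t ω) +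
      if response (graphOf ω) (beliefOf ω) (lowOf s t ω) (s t) = false then -1 else 1 := by
  obtain ⟨h1, h2⟩ := lowOf_succ_of_fresh h ω
  rw [h2, bias_update, h1]
  cases response (graphOf ω) (beliefOf ω) (lowOf s t ω) (s t) <;> simp [score]

lemma bias_lowOf_succ_ge (s : ℕ → V) (t : ℕ) (ω : Sym2 V ⊕ V → Bool) :
    bias (lowOf s t ω) - 2 ≤ bias (lowOf s (t + 1) ω) := by
  simp only [lowOf, low]
  rw [bias_update]
  have h1 : score (low (graphOf ω) (beliefOf ω) s t (s t)) ≤ 1 := score_some_le_one _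
  have h2 := score_some_false_le (some
    (if low (graphOf ω) (beliefOf ω) s t (s t) = none then
      response (graphOf ω) (beliefOf ω) (low (graphOf ω) (beliefOf ω) s t) (s t) else false))
  have h3 : score (some false) = -1 := rfl
  omega

open scoped Classical in
/-- The exponential moment of the bias, on the event that it has been large so far. -/
noncomputable def expBias (p q : unitInterval) (ε : ℝ) (t₀ : ℕ) (s : ℕ → V) (t : ℕ) : ℝ :=
  ∫ ω, (if BiasedUntil ε t₀ s t ω then Real.exp (-(ε / 2) * bias (lowOf s t ω)) else 0)
    ∂(seedLaw V p q)

/-- The left side is cosh(ε/2) - 2ε sinh(ε/2): the first term exceeds 1 by at most ε²/4, and sinh x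
≥ x makes the second at least ε². -/
lemma exp_step_le {ε : ℝ} (hε : 0 ≤ ε) (hε1 : ε ≤ 1) :
    Real.exp (-(ε / 2)) + (Real.exp (ε / 2) - Real.exp (-(ε / 2))) * (1 / 2 - ε) ≤
      Real.exp (-(3 / 4 * ε ^ 2)) := by
  have e : Real.exp (-(ε / 2)) + (Real.exp (ε / 2) - Real.exp (-(ε / 2))) * (1 / 2 - ε) =
      Real.cosh (ε / 2) - 2 * ε * Real.sinh (ε / 2) := by
    rw [Real.cosh_eq, Real.sinh_eq]; ring
  have h1 := Real.cosh_le_exp_half_sq (ε / 2)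
  have h2 : ε / 2 ≤ Real.sinh (ε / 2) := Real.self_le_sinh_iff.2 (by positivity)
  have h3 : Real.exp ((ε / 2) ^ 2 / 2) ≤ 1 + ε ^ 2 / 4 := by
    have h := Real.one_sub_le_exp_neg ((ε / 2) ^ 2 / 2)
    have hpos := Real.exp_pos ((ε / 2) ^ 2 / 2)
    rw [Real.exp_neg] at h
    have h' : (1 - (ε / 2) ^ 2 / 2) * Real.exp ((ε / 2) ^ 2 / 2) ≤ 1 := by
      have := mul_le_mul_of_nonneg_right h hpos.le
      rwa [inv_mul_cancel₀ hpos.ne'] at this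
    set x := (ε / 2) ^ 2 / 2 with hx
    have hx0 : 0 ≤ x := by positivity
    have hx1 : x ≤ 1 / 8 := by rw [hx]; nlinarith
    have hx2 : ε ^ 2 / 4 = 2 * x := by rw [hx]; ring
    rw [hx2]
    nlinarith
  have h4 := Real.one_sub_le_exp_neg (3 / 4 * ε ^ 2)
  rw [e]
  nlinarith [mul_le_mul_of_nonneg_left h2 hε]

/-- A fresh round contributes the factor of `exp_step_le`; a repeat lowers the bias by at most 2 and
costs at most exp ε. -/
lemma expBias_le {p q : unitInterval} {ε : ℝ} (hε : 0 ≤ ε) (hε1 : ε ≤ 1 / 2) {t₀ t₁ : ℕ} {s : ℕ → V}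
    (hresp : ∀ t < t₁, s t ∉ visited s t → ∀ C : V → Opinion, announced C = visited s t →
      (t₀ ≤ t → ε * t ≤ bias C) →
      (seedLaw V p q).real {ω | response (graphOf ω) (beliefOf ω) C (s t) = false} ≤ 1 / 2 - ε)
    {t : ℕ} (ht : t ≤ t₁) :
    expBias p q ε t₀ s t ≤
      Real.exp (-(3 / 4 * ε ^ 2) * ((t : ℝ) - repeats s t) + ε * repeats s t) := by
  classical
  induction t with
  | zero =>
    have h : ∀ ω, BiasedUntil ε t₀ s 0 ω := fun ω r hr => by omega
    simp [expBias, h, lowOf, low, bias, score, repeats]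
  | succ t ih =>
    have ih' := ih (by omega)
    have hmono : ∀ ω, BiasedUntil ε t₀ s (t + 1) ω → BiasedUntil ε t₀ s t ω :=
      fun ω h r hr => h r (by omega)
    -- The constraint at round `t` is included while the weight is that of round `t`, so everything
    -- is determined by coins already exposed. Dropping this constraint bounds `M` by the previous
    -- moment.
    set M := ∫ ω, (if BiasedUntil ε t₀ s (t + 1) ω then
      Real.exp (-(ε / 2) * bias (lowOf s t ω)) else 0) ∂(seedLaw V p q) with hM
    have hM0 : 0 ≤ M := integral_nonneg fun ω => by
      simp only [Pi.zero_apply]; split_ifs <;> positivity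
    have hMle : M ≤ expBias p q ε t₀ s t := by
      refine integral_mono Integrable.of_finite Integrable.of_finite fun ω => ?_
      simp only
      by_cases h : BiasedUntil ε t₀ s (t + 1) ω
      · rw [if_pos h, if_pos (hmono ω h)]
      · rw [if_neg h]; split_ifs <;> positivity
    by_cases hfresh : s t ∈ visited s t
    · have hrep : repeats s (t + 1) = repeats s t + 1 := by rw [repeats_succ, if_pos hfresh]
      have h1 : expBias p q ε t₀ s (t + 1) ≤ Real.exp ε * M := by
        rw [hM, ← integral_const_mul]
        refine integral_mono Integrable.of_finite Integrable.of_finite fun ω => ?_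
        simp only
        split_ifs
        · rw [← Real.exp_add, Real.exp_le_exp]
          have : ((bias (lowOf s t ω) - 2 : ℤ) : ℝ) ≤ bias (lowOf s (t + 1) ω) := by
            exact_mod_cast bias_lowOf_succ_ge s t ω
          push_cast at this
          nlinarith
        · simp
      refine h1.trans ?_
      have h2 := mul_le_mul_of_nonneg_left (hMle.trans ih') (Real.exp_pos ε).le
      refine h2.trans ?_
      rw [← Real.exp_add, Real.exp_le_exp, hrep]
      push_cast
      nlinarith
    · have hrep : repeats s (t + 1) = repeats s t := by rw [repeats_succ, if_neg hfresh, add_zero]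
      have hcond : ∫ ω, (if BiasedUntil ε t₀ s (t + 1) ω ∧
            response (graphOf ω) (beliefOf ω) (lowOf s t ω) (s t) = false then
            Real.exp (-(ε / 2) * bias (lowOf s t ω)) else 0) ∂(seedLaw V p q) ≤
            (1 / 2 - ε) * M := by
        convert integral_ite_le_of_conditional (seedLaw V p q)
            (BiasedUntil ε t₀ s (t + 1)) (lowOf s t)
            (fun C ω => response (graphOf ω) (beliefOf ω) C (s t) = false)
            (seedLaw_biased_response_le (c := 1 / 2 - ε) (by linarith) hfresh
              (hresp t (by omega) hfresh))
            (w := fun C => Real.exp (-(ε / 2) * bias C)) (fun C => (Real.exp_pos _).le)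
      have h1 : expBias p q ε t₀ s (t + 1) = Real.exp (-(ε / 2)) * M +
          (Real.exp (ε / 2) - Real.exp (-(ε / 2))) *
          ∫ ω, (if BiasedUntil ε t₀ s (t + 1) ω ∧
            response (graphOf ω) (beliefOf ω) (lowOf s t ω) (s t) = false then
            Real.exp (-(ε / 2) * bias (lowOf s t ω)) else 0) ∂(seedLaw V p q) := by
        rw [hM, ← integral_const_mul, ← integral_const_mul,
          ← integral_add Integrable.of_finite Integrable.of_finite]
        refine integral_congr_ae (.of_forall fun ω => ?_)
        simp only [bias_lowOf_succ_of_fresh hfresh]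
        by_cases hB : BiasedUntil ε t₀ s (t + 1) ω
        · by_cases hR : response (graphOf ω) (beliefOf ω) (lowOf s t ω) (s t) = false
          · simp only [hB, hR, if_true, and_self]
            rw [← add_mul, add_sub_cancel, ← Real.exp_add]
            push_cast
            congr 1
            ring
          · rw [if_pos hB, if_neg hR, if_pos hB, if_neg (fun h => hR h.2), mul_zero, add_zero, ← Real.exp_add]
            push_cast
            congr 1
            ring
        · simp [hB]
      have hdiff : 0 ≤ Real.exp (ε / 2) - Real.exp (-(ε / 2)) := by
        rw [sub_nonneg, Real.exp_le_exp]; linarith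
      have h2 : expBias p q ε t₀ s (t + 1) ≤ Real.exp (-(3 / 4 * ε ^ 2)) * M := by
        rw [h1]
        refine le_trans ?_ (mul_le_mul_of_nonneg_right (exp_step_le hε (by linarith)) hM0)
        have := mul_le_mul_of_nonneg_left hcond hdiff
        rw [add_mul, mul_assoc (Real.exp (ε / 2) - Real.exp (-(ε / 2)))]
        linarith
      refine h2.trans ((mul_le_mul_of_nonneg_left (hMle.trans ih')
        (Real.exp_pos _).le).trans (le_of_eq ?_))
      rw [← Real.exp_add, hrep]
      push_cast
      congr 1
      ring

/-- Markov's inequality. Per round the drift yields 3ε²/4, the threshold takes ε²/2, and the repeats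
take less than ε²/8, leaving at least ε²/8. -/
lemma seedLaw_first_unbiased_le {p q : unitInterval} {ε : ℝ} (hε : 0 ≤ ε) (hε1 : ε ≤ 1 / 2)
    {t₀ t₁ : ℕ} {s : ℕ → V}
    (hresp : ∀ t < t₁, s t ∉ visited s t → ∀ C : V → Opinion, announced C = visited s t →
      (t₀ ≤ t → ε * t ≤ bias C) →
      (seedLaw V p q).real {ω | response (graphOf ω) (beliefOf ω) C (s t) = false} ≤ 1 / 2 - ε)
    {t : ℕ} (ht : t ≤ t₁) (hrep : (repeats s t : ℝ) ≤ ε / 16 * t) :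
    (seedLaw V p q).real {ω | BiasedUntil ε t₀ s t ω ∧ (bias (lowOf s t ω) : ℝ) < ε * t} ≤
      Real.exp (-(ε ^ 2 / 8)) ^ t := by
  classical
  have h1 : (seedLaw V p q).real
      {ω | BiasedUntil ε t₀ s t ω ∧ (bias (lowOf s t ω) : ℝ) < ε * t} ≤
      Real.exp (ε / 2 * (ε * t)) * expBias p q ε t₀ s t := by
    rw [expBias, ← integral_const_mul, ← integral_indicator_one (Set.toFinite _).measurableSet]
    refine integral_mono Integrable.of_finite Integrable.of_finite fun ω => ?_
    simp only [Set.indicator_apply, Set.mem_ofPred_eq, Pi.one_apply]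
    by_cases hB : BiasedUntil ε t₀ s t ω
    · simp only [hB, true_and, if_true]
      rw [← Real.exp_add]
      split_ifs with hlt
      · rw [Real.one_le_exp_iff]
        nlinarith
      · positivity
    · simp [hB]
  refine h1.trans ((mul_le_mul_of_nonneg_left (expBias_le hε hε1 hresp ht)
    (Real.exp_pos _).le).trans ?_)
  rw [← Real.exp_add, ← Real.exp_nat_mul, Real.exp_le_exp]
  have h0 : (0 : ℝ) ≤ repeats s t := by positivity
  nlinarith [mul_le_mul_of_nonneg_left hrep hε, mul_nonneg hε h0,
    mul_le_mul_of_nonneg_right hε1 (mul_nonneg hε h0)]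

/-- Splits by the first round in which the bias falls short and sums a geometric series starting at
`t₀`. -/
lemma seedLaw_not_biasedUntil_le {p q : unitInterval} {ε : ℝ} (hε : 0 < ε) (hε1 : ε ≤ 1 / 2)
    {t₀ t₁ : ℕ} {s : ℕ → V}
    (hresp : ∀ t < t₁, s t ∉ visited s t → ∀ C : V → Opinion, announced C = visited s t →
      (t₀ ≤ t → ε * t ≤ bias C) →
      (seedLaw V p q).real {ω | response (graphOf ω) (beliefOf ω) C (s t) = false} ≤ 1 / 2 - ε)
    (hrep : ∀ t ≤ t₁, (repeats s t : ℝ) ≤ ε / 16 * t) :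
    (seedLaw V p q).real {ω | ¬ BiasedUntil ε t₀ s t₁ ω} ≤
      Real.exp (-(ε ^ 2 / 8)) ^ t₀ / (1 - Real.exp (-(ε ^ 2 / 8))) := by
  set x := Real.exp (-(ε ^ 2 / 8)) with hx
  have hx0 : 0 ≤ x := (Real.exp_pos _).le
  have hx1 : x < 1 := by rw [hx, Real.exp_lt_one_iff]; nlinarith [sq_pos_of_pos hε]
  have hsub : {ω | ¬ BiasedUntil ε t₀ s t₁ ω} ⊆ ⋃ t ∈ Finset.Ico t₀ t₁,
      {ω | BiasedUntil ε t₀ s t ω ∧ (bias (lowOf s t ω) : ℝ) < ε * t} := by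
    intro ω hω
    simp only [Set.mem_ofPred_eq, BiasedUntil] at hω
    push Not at hω
    classical
    obtain ⟨h1, h2, h3⟩ := Nat.find_spec hω
    simp only [Set.mem_iUnion, Finset.mem_Ico, Set.mem_ofPred_eq]
    refine ⟨Nat.find hω, ⟨h2, h1⟩, fun r hr hr0 => ?_, h3⟩
    have := Nat.find_min hω hr
    push Not at this
    exact this (by omega) hr0
  refine (measureReal_mono hsub (measure_ne_top _ _)).trans
    ((measureReal_biUnion_finset_le _ _).trans ?_)
  have hle : ∀ t ∈ Finset.Ico t₀ t₁, (seedLaw V p q).real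
      {ω | BiasedUntil ε t₀ s t ω ∧ (bias (lowOf s t ω) : ℝ) < ε * t} ≤ x ^ t := fun t ht =>
    seedLaw_first_unbiased_le hε.le hε1 hresp (Finset.mem_Ico.1 ht).2.le
      (hrep t (Finset.mem_Ico.1 ht).2.le)
  refine (Finset.sum_le_sum hle).trans ?_
  exact geom_sum_Ico_le_of_lt_one hx0 hx1

end FixedSelection

/-! ### Positive margins at all nodes -/

section Consensus

variable {V : Type*} [Fintype V] [DecidableEq V]

lemma hits_mono {S T : Finset V} (h : S ⊆ T) (x : V → Bool) : hits S x ≤ hits T x :=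
  Finset.sum_le_sum_of_subset h

/-- The nodes selected exactly once before round `t₁`, and not before round `t₀`. -/
def selectedOnce (s : ℕ → V) (t₀ t₁ : ℕ) : Finset V :=
  {w | ∃ i < t₁, t₀ ≤ i ∧ s i = w ∧ ∀ j < t₁, s j = w → j = i}

lemma mem_selectedOnce {s : ℕ → V} {t₀ t₁ : ℕ} {w : V} :
    w ∈ selectedOnce s t₀ t₁ ↔ ∃ i < t₁, t₀ ≤ i ∧ s i = w ∧ ∀ j < t₁, s j = w → j = i := by
  simp [selectedOnce]

lemma selectedOnce_subset (s : ℕ → V) (t₀ t₁ : ℕ) : selectedOnce s t₀ t₁ ⊆ visited s t₁ := by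
  intro w hw
  obtain ⟨i, hi, -, rfl, -⟩ := mem_selectedOnce.1 hw
  exact mem_visited.2 ⟨i, hi, rfl⟩

/-- A visited node left out either appeared before `t₀` or accounts for a repeat. -/
lemma card_visited_sdiff_selectedOnce_le (s : ℕ → V) (t₀ t₁ : ℕ) :
    (visited s t₁ \ selectedOnce s t₀ t₁).card ≤ t₀ + repeats s t₁ := by
  classical
  have hsub : visited s t₁ \ selectedOnce s t₀ t₁ ⊆
      visited s t₀ ∪ ((Finset.range t₁).filter fun i => s i ∈ visited s i).image s := by
    intro w hw
    rw [Finset.mem_sdiff] at hw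
    obtain ⟨hvis, hnot⟩ := hw
    have hex : ∃ i, i < t₁ ∧ s i = w := mem_visited.1 hvis
    obtain ⟨hi, hiw⟩ := Nat.find_spec hex
    rw [Finset.mem_union]
    by_cases h0 : Nat.find hex < t₀
    · exact Or.inl (mem_visited.2 ⟨_, h0, hiw⟩)
    · right
      have : ∃ j < t₁, s j = w ∧ j ≠ Nat.find hex := by
        by_contra hcon
        push Not at hcon
        exact hnot (mem_selectedOnce.2 ⟨_, hi, by omega, hiw, hcon⟩)
      obtain ⟨j, hj, hjw, hne⟩ := this
      have hlt : Nat.find hex < j := lt_of_le_of_ne (Nat.find_min' hex ⟨hj, hjw⟩) (Ne.symm hne)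
      rw [Finset.mem_image]
      refine ⟨j, ?_, hjw⟩
      rw [Finset.mem_filter, Finset.mem_range]
      exact ⟨hj, mem_visited.2 ⟨_, hlt, hiw.trans hjw.symm⟩⟩
  refine (Finset.card_le_card hsub).trans ((Finset.card_union_le _ _).trans ?_)
  refine add_le_add ?_ Finset.card_image_le
  exact Finset.card_image_le.trans (by simp)

lemma lowOf_eq_true_of_once {s : ℕ → V} {t₁ i : ℕ} {ω : Sym2 V ⊕ V → Bool} (hi : i < t₁)
    (honce : ∀ j < t₁, s j = s i → j = i)
    (hresp : response (graphOf ω) (beliefOf ω) (lowOf s i ω) (s i) ≠ false) :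
    lowOf s t₁ ω (s i) = some true := by
  have hfresh : s i ∉ visited s i := by
    rw [mem_visited]
    rintro ⟨j, hj, hji⟩
    exact absurd (honce j (by omega) hji) (by omega)
  have key : ∀ t, i + 1 ≤ t → t ≤ t₁ → lowOf s t ω (s i) = some true := by
    intro t ht
    induction t, ht using Nat.le_induction with
    | base =>
      intro _
      rw [(lowOf_succ_of_fresh hfresh ω).2, Function.update_self]
      simpa using hresp
    | succ t ht ih =>
      intro ht₁
      have hne : s i ≠ s t := fun h => by
        have := honce t (by omega) h.symm
        omega
      have ih' := ih (by omega)
      simp only [lowOf, low] at ih' ⊢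
      rw [Function.update_of_ne hne]
      exact ih'
  exact key t₁ hi le_rfl

/-- Late nodes selected once are correct, and all other visited nodes are counted as wrong. Both
groups are determined by the selections alone, so their edges to `v` can be estimated without
conditioning on announcements. -/
lemma margin_lowOf_pos {s : ℕ → V} {t₀ t₁ : ℕ} {ω : Sym2 V ⊕ V → Bool}
    (hresp : ∀ i < t₁, t₀ ≤ i → s i ∉ visited s i →
      response (graphOf ω) (beliefOf ω) (lowOf s i ω) (s i) ≠ false) {v : V}
    (hhits : hits ((visited s t₁ \ selectedOnce s t₀ t₁).erase v) (fun w => ω (Sum.inl s(v, w))) <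
      hits ((selectedOnce s t₀ t₁).erase v) (fun w => ω (Sum.inl s(v, w)))) :
    0 < margin (graphOf ω) (lowOf s t₁ ω) v := by
  have htrue : ∀ w ∈ selectedOnce s t₀ t₁, lowOf s t₁ ω w = some true := by
    intro w hw
    obtain ⟨i, hi, hi0, rfl, honce⟩ := mem_selectedOnce.1 hw
    refine lowOf_eq_true_of_once hi honce (hresp i hi hi0 ?_)
    rw [mem_visited]
    rintro ⟨j, hj, hji⟩
    exact absurd (honce j (by omega) hji) (by omega)
  have h1 : (selectedOnce s t₀ t₁).erase v ⊆ (announcing (lowOf s t₁ ω) (some true)).erase v :=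
    Finset.erase_subset_erase _ fun w hw => by simp [announcing, htrue w hw]
  have h2 : (announcing (lowOf s t₁ ω) (some false)).erase v ⊆
      (visited s t₁ \ selectedOnce s t₀ t₁).erase v := by
    refine Finset.erase_subset_erase _ fun w hw => ?_
    have hw' : lowOf s t₁ ω w = some false := by simpa [announcing] using hw
    rw [Finset.mem_sdiff, ← announced_lowOf s t₁ ω]
    refine ⟨by simp [announced, hw'], fun h => ?_⟩
    rw [htrue w h] at hw'
    simp at hw'
  rw [margin_graphOf]
  have h3 := hits_mono h1 (fun w => ω (Sum.inl s(v, w)))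
  have h4 := hits_mono h2 (fun w => ω (Sum.inl s(v, w)))
  omega

/-- With high probability the pessimistic process reaches a state in which every node has a
majority of correct announcements among its neighbours. -/
lemma seedLaw_exists_margin_nonpos_le {p q : unitInterval} (hp : (p : ℝ) ≤ 1 / 2) {δ : ℝ}
    (hδ : 0 < δ) (hδ' : δ < 1 / 2) (hq : (q : ℝ) = 1 / 2 + δ) {a t₀ : ℕ} {s : ℕ → V}
    (ha : (p : ℝ) * a ≤ δ / 2) (hat₀ : a ≤ t₀) (ht₀ : 1 ≤ t₀)
    (hrep : ∀ t ≤ 10 * t₀, (repeats s t : ℝ) ≤ drift δ / 16 * t) :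
    (seedLaw V p q).real {ω | ∃ v, margin (graphOf ω) (lowOf s (10 * t₀) ω) v ≤ 0} ≤
      Real.exp (-(drift δ ^ 2 / 8)) ^ a / (1 - Real.exp (-(drift δ ^ 2 / 8))) +
      (10 * t₀ + Fintype.card V) * Real.exp (-(p * drift δ ^ 2 * t₀ / 8)) := by
  classical
  set ε := drift δ with hεdef
  have hε : 0 < ε := drift_pos hδ
  have hε1 : ε ≤ 1 / 100 := drift_le δ
  have hp0 : (0 : ℝ) ≤ p := p.2.1
  set t₁ := 10 * t₀ with ht₁
  set μ := seedLaw V p q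
  set κ := Real.exp (-(p * ε ^ 2 * t₀ / 8)) with hκ
  have hcardle : ∀ t, ((visited s t).card : ℝ) ≤ t := fun t => by
    have := card_visited_add_repeats s t
    exact_mod_cast (by omega : (visited s t).card ≤ t)
  have hnone : ∀ {t} {C : V → Opinion}, s t ∉ visited s t → announced C = visited s t →
      C (s t) = none := by
    intro t C hf hC
    by_contra h
    rw [← hC] at hf
    exact hf (by simp [announced, h])
  -- The two regimes meet at round `a`: before it announcements are sparse at scale 1/p, from it on
  -- the assumed bias takes over.
  have hresp : ∀ t < t₁, s t ∉ visited s t → ∀ C : V → Opinion, announced C = visited s t →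
      (a ≤ t → ε * t ≤ bias C) →
      μ.real {ω | response (graphOf ω) (beliefOf ω) C (s t) = false} ≤ 1 / 2 - ε := by
    intro t _ hf C hC hb
    refine response_false_le_half_sub hp hδ hδ' hq (hnone hf hC) ?_
    rw [hC]
    by_cases hat : a ≤ t
    · right
      exact (mul_le_mul_of_nonneg_left (hcardle t) hε.le).trans (hb hat)
    · left
      refine le_trans ?_ ha
      have : (t : ℝ) ≤ a := by exact_mod_cast (by omega : t ≤ a)
      exact mul_le_mul_of_nonneg_left ((hcardle t).trans this) hp0
  have hB := seedLaw_not_biasedUntil_le hε (by linarith) hresp hrep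
  have hlate : ∀ t ∈ Finset.range t₁, μ.real {ω | t₀ ≤ t ∧ s t ∉ visited s t ∧
      BiasedUntil ε a s t₁ ω ∧
      response (graphOf ω) (beliefOf ω) (lowOf s t ω) (s t) = false} ≤ κ := by
    intro t ht
    rw [Finset.mem_range] at ht
    by_cases h : t₀ ≤ t ∧ s t ∉ visited s t
    · obtain ⟨h0, hf⟩ := h
      have hcond := integral_ite_le_of_conditional μ (BiasedUntil ε a s (t + 1)) (lowOf s t)
        (fun C ω => response (graphOf ω) (beliefOf ω) C (s t) = false)
        (seedLaw_biased_response_le (c := κ) (Real.exp_pos _).le hf (fun C hC hb => by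
          have hb' := hb (hat₀.trans h0)
          refine (response_false_le_exp hε.le (hnone hf hC) ?_).trans ?_
          · rw [hC]
            exact (mul_le_mul_of_nonneg_left (hcardle t) hε.le).trans hb'
          · rw [hκ, Real.exp_le_exp, hC, neg_le_neg_iff]
            have h1 : ((visited s t).card : ℝ) + repeats s t = t := by
              exact_mod_cast card_visited_add_repeats s t
            have h2 := hrep t ht.le
            have h3 : (t₀ : ℝ) ≤ t := by exact_mod_cast h0
            have h4 : (t₀ : ℝ) / 2 ≤ (visited s t).card := by nlinarith
            have h5 : 0 ≤ (p : ℝ) * ε ^ 2 := by positivity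
            nlinarith [mul_le_mul_of_nonneg_left h4 h5]))
        (w := fun _ => 1) (fun _ => zero_le_one)
      have h1 : ∫ ω, (if BiasedUntil ε a s (t + 1) ω then (1 : ℝ) else 0) ∂μ ≤ 1 := by
        have : ∫ ω, (if BiasedUntil ε a s (t + 1) ω then (1 : ℝ) else 0) ∂μ ≤ ∫ _, (1 : ℝ) ∂μ :=
          integral_mono Integrable.of_finite Integrable.of_finite fun ω => by
            simp only; split_ifs <;> norm_num
        simpa using this
      have h2 : μ.real {ω | t₀ ≤ t ∧ s t ∉ visited s t ∧ BiasedUntil ε a s t₁ ω ∧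
          response (graphOf ω) (beliefOf ω) (lowOf s t ω) (s t) = false} ≤
          ∫ ω, (if BiasedUntil ε a s (t + 1) ω ∧
            response (graphOf ω) (beliefOf ω) (lowOf s t ω) (s t) = false then (1 : ℝ) else 0)
            ∂μ := by
        rw [← integral_indicator_one (Set.toFinite _).measurableSet]
        refine integral_mono Integrable.of_finite Integrable.of_finite fun ω => ?_
        simp only [Set.indicator_apply, Set.mem_ofPred_eq, Pi.one_apply]
        by_cases hω : t₀ ≤ t ∧ s t ∉ visited s t ∧ BiasedUntil ε a s t₁ ω ∧
          response (graphOf ω) (beliefOf ω) (lowOf s t ω) (s t) = false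
        · rw [if_pos hω, if_pos ⟨fun r hr => hω.2.2.1 r (by omega), hω.2.2.2⟩]
        · rw [if_neg hω]; split_ifs <;> norm_num
      have h3 : ∫ ω, (if BiasedUntil ε a s (t + 1) ω ∧
            response (graphOf ω) (beliefOf ω) (lowOf s t ω) (s t) = false then (1 : ℝ) else 0)
            ∂μ ≤ κ * ∫ ω, (if BiasedUntil ε a s (t + 1) ω then (1 : ℝ) else 0) ∂μ := by
        convert hcond
      exact h2.trans (h3.trans (mul_le_of_le_one_right (Real.exp_pos _).le h1))
    · have : {ω : Sym2 V ⊕ V → Bool | t₀ ≤ t ∧ s t ∉ visited s t ∧ BiasedUntil ε a s t₁ ω ∧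
          response (graphOf ω) (beliefOf ω) (lowOf s t ω) (s t) = false} = ∅ := by
        ext ω
        simp only [Set.mem_ofPred_eq, Set.mem_empty_iff_false, iff_false]
        exact fun hω => h ⟨hω.1, hω.2.1⟩
      rw [this, measureReal_empty]
      exact (Real.exp_pos _).le
  have hdeg : ∀ v ∈ (Finset.univ : Finset V), μ.real {ω |
      hits ((selectedOnce s t₀ t₁).erase v) (fun w => ω (Sum.inl s(v, w))) ≤
      hits ((visited s t₁ \ selectedOnce s t₀ t₁).erase v) (fun w => ω (Sum.inl s(v, w)))} ≤ κ := by
    intro v _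
    set A := (selectedOnce s t₀ t₁).erase v with hA
    set B := (visited s t₁ \ selectedOnce s t₀ t₁).erase v with hBdef
    have hdisj : Disjoint A B := Finset.disjoint_of_subset_left (Finset.erase_subset _ _)
      (Finset.disjoint_of_subset_right (Finset.erase_subset _ _) Finset.disjoint_sdiff)
    have c1 : (selectedOnce s t₀ t₁).card - 1 ≤ A.card := Finset.pred_card_le_card_erase
    have c1' : A.card ≤ (selectedOnce s t₀ t₁).card := Finset.card_erase_le
    have c2 : B.card ≤ (visited s t₁ \ selectedOnce s t₀ t₁).card := Finset.card_erase_le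
    have c2' : (visited s t₁ \ selectedOnce s t₀ t₁).card - 1 ≤ B.card :=
      Finset.pred_card_le_card_erase
    have c3 := card_visited_sdiff_selectedOnce_le s t₀ t₁
    have c4 := Finset.card_sdiff_add_card_eq_card (selectedOnce_subset s t₀ t₁)
    have c5 := card_visited_add_repeats s t₁
    have c6 : (repeats s t₁ : ℝ) ≤ t₀ := by
      refine (hrep t₁ le_rfl).trans ?_
      rw [ht₁]
      push_cast
      have : (0 : ℝ) ≤ t₀ := by positivity
      nlinarith
    have c7 : repeats s t₁ ≤ t₀ := by exact_mod_cast c6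
    -- With at most t₀ repeats, at least 7t₀ nodes are in `selectedOnce` and at most 2t₀ visited
    -- nodes are not; erasing `v` costs at most one, absorbed by t₀ ≥ 1.
    have d1 : 2 * t₀ + B.card ≤ A.card := by omega
    have d2 : A.card + B.card ≤ 10 * t₀ := by omega
    have d1' : 2 * (t₀ : ℝ) + B.card ≤ A.card := by exact_mod_cast d1
    have d2' : (A.card : ℝ) + B.card ≤ 10 * t₀ := by exact_mod_cast d2
    have hBn : (0 : ℝ) ≤ B.card := by positivity
    have hAn : (0 : ℝ) ≤ A.card := by positivity
    have hbound := coins_hits_le_hits p hε.le hdisj (by nlinarith)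
    rw [← seedLaw_edges_at p q v] at hbound
    refine hbound.trans ?_
    rw [hκ, Real.exp_le_exp, neg_le_neg_iff]
    have h5 : 0 ≤ (p : ℝ) * ε ^ 2 := by positivity
    have h6 : (t₀ : ℝ) / 2 ≤ A.card + B.card := by
      have : (0 : ℝ) ≤ t₀ := by positivity
      linarith
    nlinarith [mul_le_mul_of_nonneg_left h6 h5]
  have hsub : {ω | ∃ v, margin (graphOf ω) (lowOf s t₁ ω) v ≤ 0} ⊆
      {ω | ¬ BiasedUntil ε a s t₁ ω} ∪
      ((⋃ t ∈ Finset.range t₁, {ω | t₀ ≤ t ∧ s t ∉ visited s t ∧ BiasedUntil ε a s t₁ ω ∧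
        response (graphOf ω) (beliefOf ω) (lowOf s t ω) (s t) = false}) ∪
      ⋃ v ∈ (Finset.univ : Finset V), {ω |
        hits ((selectedOnce s t₀ t₁).erase v) (fun w => ω (Sum.inl s(v, w))) ≤
        hits ((visited s t₁ \ selectedOnce s t₀ t₁).erase v) (fun w => ω (Sum.inl s(v, w)))}) := by
    rintro ω ⟨v, hv⟩
    by_contra hcon
    simp only [Set.mem_union, Set.mem_iUnion, Set.mem_ofPred_eq, Finset.mem_range, Finset.mem_univ,
      not_or, not_not, not_exists, not_and, not_le] at hcon
    obtain ⟨h1, h2, h3⟩ := hcon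
    exact absurd (margin_lowOf_pos (fun i hi hi0 hf => h2 i hi hi0 hf h1) (h3 v trivial))
      (not_lt.2 hv)
  refine (measureReal_mono hsub (measure_ne_top _ _)).trans
    ((measureReal_union_le _ _).trans (add_le_add hB ?_))
  refine (measureReal_union_le _ _).trans ?_
  rw [add_mul]
  refine add_le_add ?_ ?_
  · refine (measureReal_biUnion_finset_le _ _).trans ((Finset.sum_le_card_nsmul _ _ _ hlate).trans ?_)
    rw [Finset.card_range, nsmul_eq_mul, ht₁]
    push_cast
    rfl
  · refine (measureReal_biUnion_finset_le _ _).trans ((Finset.sum_le_card_nsmul _ _ _ hdeg).trans ?_)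
    rw [nsmul_eq_mul, Finset.card_univ]

end Consensus

/-! ### Repeats, last appearances and coupon collecting -/

section Selection

/-- The law of the sequence of selected nodes. -/
noncomputable abbrev selectionLaw (n : ℕ) : Measure (ℕ → Fin n) :=
  Measure.infinitePi fun _ : ℕ => uniformOn (Set.univ : Set (Fin n))

variable {n : ℕ} [NeZero n]

lemma uniformOn_univ_real_singleton (v : Fin n) :
    (uniformOn (Set.univ : Set (Fin n))).real {v} = 1 / n := by
  rw [measureReal_def, uniformOn_univ]
  simp

lemma map_add_right_uniformOn (c : Fin n) :
    (uniformOn (Set.univ : Set (Fin n))).map (fun x => x + c) = uniformOn Set.univ := by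
  ext S hS
  rw [Measure.map_apply (by fun_prop) hS, uniformOn_univ, uniformOn_univ]
  congr 1
  exact measure_preimage_add_right Measure.count c S

/-- A property of the selections that depends on finitely many rounds only is measurable. -/
lemma measurableSet_of_forall_lt {P : (ℕ → Fin n) → Prop} {t : ℕ}
    (h : ∀ s s' : ℕ → Fin n, (∀ i < t, s i = s' i) → (P s ↔ P s')) : MeasurableSet {s | P s} := by
  have hdep : DependsOn P (Finset.range t : Set ℕ) := fun s s' hs =>
    propext (h s s' fun i hi => hs i (by simpa using hi))
  obtain ⟨g, rfl⟩ := dependsOn_iff_exists_comp.1 hdep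
  have hg : MeasurableSet {x : ↥(Finset.range t : Set ℕ) → Fin n | g x} :=
    (Set.toFinite _).measurableSet
  have hr : Measurable (fun (s : ℕ → Fin n) => (Finset.range t : Set ℕ).domRestrict s) :=
    measurable_pi_lambda _ fun i => measurable_pi_apply _
  exact hr hg

lemma selectionLaw_eq_le {i j : ℕ} (hij : j ≠ i) :
    (selectionLaw n).real {s | s j = s i} ≤ 1 / n := by
  have hsub : {s : ℕ → Fin n | s j = s i} ⊆ ⋃ v ∈ (Finset.univ : Finset (Fin n)),
      Set.pi (({i, j} : Finset ℕ) : Set ℕ) fun _ => {v} := by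
    intro s hs
    have hs' : s j = s i := hs
    simp [hs']
  have hv : ∀ v ∈ (Finset.univ : Finset (Fin n)),
      (selectionLaw n).real (Set.pi (({i, j} : Finset ℕ) : Set ℕ) fun _ => {v}) ≤ (1 / n) ^ 2 := by
    intro v _
    rw [measureReal_def, Measure.infinitePi_pi _ (fun _ _ => .of_discrete), ENNReal.toReal_prod]
    simp only [← measureReal_def, uniformOn_univ_real_singleton]
    rw [Finset.prod_const, Finset.card_pair hij.symm]
  refine (measureReal_mono hsub (measure_ne_top _ _)).trans
    ((measureReal_biUnion_finset_le _ _).trans ((Finset.sum_le_card_nsmul _ _ _ hv).trans ?_))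
  have hn : (n : ℝ) ≠ 0 := by exact_mod_cast NeZero.ne n
  rw [Finset.card_univ, Fintype.card_fin, nsmul_eq_mul]
  apply le_of_eq
  field_simp

lemma selectionLaw_mem_visited_le (i : ℕ) :
    (selectionLaw n).real {s | s i ∈ visited s i} ≤ i / n := by
  have hsub : {s : ℕ → Fin n | s i ∈ visited s i} ⊆ ⋃ j ∈ Finset.range i, {s | s j = s i} := by
    intro s hs
    obtain ⟨j, hj, hji⟩ := mem_visited.1 (show s i ∈ visited s i from hs)
    simp only [Set.mem_iUnion, Finset.mem_range]
    exact ⟨j, hj, hji⟩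
  refine (measureReal_mono hsub (measure_ne_top _ _)).trans
    ((measureReal_biUnion_finset_le _ _).trans ((Finset.sum_le_card_nsmul _ _ _ fun j hj =>
      selectionLaw_eq_le (n := n) (Finset.mem_range.1 hj).ne).trans ?_))
  rw [Finset.card_range, nsmul_eq_mul, mul_one_div]

lemma visited_congr {V : Type*} [DecidableEq V] {s s' : ℕ → V} {t : ℕ}
    (h : ∀ i < t, s i = s' i) : visited s t = visited s' t :=
  Finset.image_congr fun i hi => h i (by simpa using hi)

lemma repeats_congr {V : Type*} [Fintype V] [DecidableEq V] {s s' : ℕ → V} {t : ℕ}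
    (h : ∀ i < t, s i = s' i) : repeats s t = repeats s' t := by
  unfold repeats
  congr 1
  refine Finset.filter_congr fun i hi => ?_
  rw [Finset.mem_range] at hi
  rw [h i hi, visited_congr fun j hj => h j (by omega)]

lemma low_congr {V : Type*} [Fintype V] [DecidableEq V] (G : SimpleGraph V) (X : V → Bool)
    {s s' : ℕ → V} {t : ℕ} (h : ∀ i < t, s i = s' i) : low G X s t = low G X s' t := by
  induction t with
  | zero => rfl
  | succ t ih =>
    simp only [low]
    rw [ih fun i hi => h i (by omega), h t (by omega)]

/-- All prefixes are handled at once by weighting a repeat in round i with 1/(i+1): the weighted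
count `Q` dominates every ratio `repeats s t / t`, while its mean is at most t₁/n because round i is
a repeat with probability at most i/n. -/
lemma selectionLaw_many_repeats_le {η : ℝ} (hη : 0 < η) (t₁ : ℕ) :
    (selectionLaw n).real {s | ∃ t ≤ t₁, η * t < repeats s t} ≤ t₁ / (η * n) := by
  have hn : (0 : ℝ) < n := by exact_mod_cast NeZero.pos n
  let R : ℕ → Set (ℕ → Fin n) := fun i => {s | s i ∈ visited s i}
  have hRm : ∀ i, MeasurableSet (R i) := fun i =>
    measurableSet_of_forall_lt (t := i + 1) fun s s' h => by
      rw [h i (by omega), visited_congr fun j hj => h j (by omega)]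
  let Q : (ℕ → Fin n) → ℝ := fun s => ∑ i ∈ Finset.range t₁,
    1 / ((i : ℝ) + 1) * (R i).indicator 1 s
  have hi : ∀ i : ℕ, Integrable (fun s => 1 / ((i : ℝ) + 1) * (R i).indicator 1 s) (selectionLaw n) :=
    fun i => ((integrable_const (1 : ℝ)).indicator (hRm i)).const_mul _
  have hQi : Integrable Q (selectionLaw n) := integrable_finsetSum _ fun i _ => hi i
  have hQ0 : ∀ s, 0 ≤ Q s := fun s => Finset.sum_nonneg fun i _ =>
    mul_nonneg (by positivity) (Set.indicator_nonneg (fun _ _ => zero_le_one) _)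
  have hsub : {s : ℕ → Fin n | ∃ t ≤ t₁, η * t < repeats s t} ⊆ {s | η ≤ Q s} := by
    rintro s ⟨t, ht, hlt⟩
    have ht0 : 0 < t := by
      rcases Nat.eq_zero_or_pos t with rfl | h
      · simp [repeats] at hlt
      · exact h
    have ht0' : (0 : ℝ) < t := by exact_mod_cast ht0
    have h1 : (repeats s t : ℝ) / t ≤ Q s := by
      have h2 : (repeats s t : ℝ) / t = ∑ i ∈ Finset.range t, 1 / (t : ℝ) * (R i).indicator 1 s := by
        simp only [repeats, Finset.card_filter, R, Set.indicator_apply, Set.mem_ofPred_eq,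
          Pi.one_apply]
        push_cast
        rw [← Finset.mul_sum]
        ring
      rw [h2]
      refine le_trans (Finset.sum_le_sum (g := fun i : ℕ => 1 / ((i : ℝ) + 1) *
        (R i).indicator 1 s) fun i hi => ?_) ?_
      · refine mul_le_mul_of_nonneg_right ?_ (Set.indicator_nonneg (fun _ _ => zero_le_one) _)
        have : ((i : ℝ) + 1) ≤ t := by exact_mod_cast Finset.mem_range.1 hi
        gcongr
      · refine Finset.sum_le_sum_of_subset_of_nonneg (by simpa using ht) fun i _ _ => ?_
        exact mul_nonneg (by positivity) (Set.indicator_nonneg (fun _ _ => zero_le_one) _)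
    refine le_trans ?_ h1
    rw [le_div_iff₀ ht0']
    exact hlt.le
  have hintegral : ∫ s, Q s ∂(selectionLaw n) ≤ t₁ / n := by
    simp only [Q]
    rw [integral_finsetSum _ fun i _ => hi i]
    refine (Finset.sum_le_card_nsmul _ _ (1 / (n : ℝ)) fun i _ => ?_).trans ?_
    · rw [integral_const_mul, integral_indicator_one (hRm i)]
      have h1 := selectionLaw_mem_visited_le (n := n) i
      calc 1 / ((i : ℝ) + 1) * (selectionLaw n).real (R i) ≤ 1 / ((i : ℝ) + 1) * (i / n) := by
            gcongr
        _ = (i / ((i : ℝ) + 1)) * (1 / n) := by ring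
        _ ≤ 1 * (1 / n) := by
            gcongr
            rw [div_le_one (by positivity)]
            linarith
        _ = 1 / n := one_mul _
    · rw [Finset.card_range, nsmul_eq_mul, mul_one_div]
  have hmarkov := mul_meas_ge_le_integral_of_nonneg (.of_forall hQ0) hQi η
  refine (measureReal_mono hsub (measure_ne_top _ _)).trans ?_
  rw [le_div_iff₀ (by positivity)]
  have h3 := hmarkov.trans hintegral
  rw [le_div_iff₀ hn] at h3
  linarith

lemma measurableSet_isLastFrom (t₁ i : ℕ) :
    MeasurableSet {s : ℕ → Fin n | IsLastFrom t₁ s (s i)} := by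
  have h2 : ∀ j k : ℕ, Measurable fun s : ℕ → Fin n => s j = s k := fun j k =>
    measurableSet_setOfPred.1 (measurableSet_eq_fun (measurable_pi_apply _) (measurable_pi_apply _))
  have h1 : ∀ (j : ℕ) (w : Fin n), Measurable fun s : ℕ → Fin n => s j = w := fun j w =>
    measurableSet_setOfPred.1 (measurableSet_eq_fun (measurable_pi_apply _) measurable_const)
  have h1' : ∀ (j : ℕ) (w : Fin n), Measurable fun s : ℕ → Fin n => w = s j := fun j w =>
    measurableSet_setOfPred.1 (measurableSet_eq_fun measurable_const (measurable_pi_apply _))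
  refine measurableSet_setOfPred.2 ?_
  unfold IsLastFrom
  refine .forall fun w => .imp (h1' _ _).not (.exists fun j => .and measurable_const
    (.and (h1 _ _) (.forall fun k => .imp measurable_const (.imp measurable_const (h2 _ _).not))))

/-- By symmetry, the node selected in an early round is unlikely to be the last one to appear. -/
lemma selectionLaw_isLastFrom_le {t₁ i : ℕ} (hi : i < t₁) :
    (selectionLaw n).real {s | IsLastFrom t₁ s (s i)} ≤ 1 / n := by
  -- Shifting only the selections from `t₁` on preserves the law, keeps `s i` and translates the
  -- last node to appear. The n preimages of `E` are equiprobable and, by `IsLastFrom.unique`,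
  -- disjoint.
  let φ : Fin n → (ℕ → Fin n) → ℕ → Fin n := fun c s j => if j < t₁ then s j else s j + c
  set E := {s : ℕ → Fin n | IsLastFrom t₁ s (s i)}
  have hE : MeasurableSet E := measurableSet_isLastFrom t₁ i
  have hφm : ∀ c, Measurable (φ c) := fun c => measurable_pi_lambda _ fun j => by
    simp only [φ]
    split_ifs
    · exact measurable_pi_apply j
    · exact (Measurable.of_discrete (f := fun x : Fin n => x + c)).comp (measurable_pi_apply j)
  have hφ : ∀ c, (selectionLaw n).map (φ c) = selectionLaw n := by
    intro c
    have := Measure.infinitePi_map_pi (fun _ : ℕ => uniformOn (Set.univ : Set (Fin n)))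
      (f := fun j x => if j < t₁ then x else x + c) (fun j => .of_discrete)
    refine this.trans ?_
    congr 1
    funext j
    by_cases hj : j < t₁
    · simp [hj]
    · simp only [hj, if_false]
      exact map_add_right_uniformOn c
  have hshift : ∀ c s, φ c s ∈ E → IsLastFrom t₁ s (s i - c) := by
    intro c s hs w hw
    have hsi : φ c s i = s i := by simp [φ, hi]
    have hs' : IsLastFrom t₁ (φ c s) (s i) := by rw [← hsi]; exact hs
    obtain ⟨j, hj, hjw, hk⟩ := hs' (w + c) (fun h => hw (eq_sub_of_add_eq h))
    refine ⟨j, hj, ?_, fun k hk1 hk2 hkv => hk k hk1 hk2 ?_⟩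
    · have : ¬ j < t₁ := by omega
      simpa [φ, this] using hjw
    · have : ¬ k < t₁ := by omega
      simp only [φ, this, if_false, hkv]
      exact sub_add_cancel _ _
  have hdisj : Set.PairwiseDisjoint (↑(Finset.univ : Finset (Fin n))) fun c => φ c ⁻¹' E := by
    intro c _ d _ hcd
    rw [Function.onFun, Set.disjoint_left]
    intro s hc hd
    have := (hshift c s hc).unique (hshift d s hd)
    exact hcd (sub_right_injective this)
  have heq : ∀ c, (selectionLaw n).real (φ c ⁻¹' E) = (selectionLaw n).real E := by
    intro c
    rw [← map_measureReal_apply (hφm c) hE, hφ c]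
  have hsum := measureReal_biUnion_finset (μ := selectionLaw n) hdisj
    (fun c _ => (hφm c) hE)
  have hle : (selectionLaw n).real (⋃ c ∈ (Finset.univ : Finset (Fin n)), φ c ⁻¹' E) ≤ 1 :=
    measureReal_le_one
  rw [hsum] at hle
  simp only [heq, Finset.sum_const, Finset.card_univ, Fintype.card_fin, nsmul_eq_mul] at hle
  have hn : (0 : ℝ) < n := by exact_mod_cast NeZero.pos n
  rw [le_div_iff₀ hn]
  linarith

lemma selectionLaw_exists_isLastFrom_le (t₁ : ℕ) :
    (selectionLaw n).real {s | ∃ i < t₁, IsLastFrom t₁ s (s i)} ≤ t₁ / n := by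
  have hsub : {s : ℕ → Fin n | ∃ i < t₁, IsLastFrom t₁ s (s i)} ⊆
      ⋃ i ∈ Finset.range t₁, {s | IsLastFrom t₁ s (s i)} := by
    rintro s ⟨i, hi, h⟩
    simp only [Set.mem_iUnion, Finset.mem_range]
    exact ⟨i, hi, h⟩
  refine (measureReal_mono hsub (measure_ne_top _ _)).trans
    ((measureReal_biUnion_finset_le _ _).trans ((Finset.sum_le_card_nsmul _ _ _ fun i hi =>
      selectionLaw_isLastFrom_le (n := n) (Finset.mem_range.1 hi)).trans ?_))
  rw [Finset.card_range, nsmul_eq_mul, mul_one_div]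

/-- The coupon collector's bound. -/
lemma selectionLaw_exists_missed_le (t₁ b : ℕ) :
    (selectionLaw n).real {s | ∃ v, ∀ i, t₁ ≤ i → i < b → s i ≠ v} ≤
      n * Real.exp (-((b - t₁ : ℕ) / n)) := by
  have hn : (0 : ℝ) < n := by exact_mod_cast NeZero.pos n
  have hsub : {s : ℕ → Fin n | ∃ v, ∀ i, t₁ ≤ i → i < b → s i ≠ v} ⊆
      ⋃ v ∈ (Finset.univ : Finset (Fin n)),
        Set.pi ((Finset.Ico t₁ b : Finset ℕ) : Set ℕ) fun _ => {v}ᶜ := by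
    rintro s ⟨v, hv⟩
    simp only [Set.mem_iUnion, Finset.mem_univ, exists_const]
    exact ⟨v, fun i hi => hv i (Finset.mem_Ico.1 hi).1 (Finset.mem_Ico.1 hi).2⟩
  have hv : ∀ v ∈ (Finset.univ : Finset (Fin n)), (selectionLaw n).real
      (Set.pi ((Finset.Ico t₁ b : Finset ℕ) : Set ℕ) fun _ => {v}ᶜ) ≤
      Real.exp (-((b - t₁ : ℕ) / n)) := by
    intro v _
    rw [measureReal_def, Measure.infinitePi_pi _ (fun _ _ => .of_discrete), ENNReal.toReal_prod]
    simp only [← measureReal_def, probReal_compl_eq_one_sub (MeasurableSet.of_discrete),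
      uniformOn_univ_real_singleton]
    rw [Finset.prod_const, Nat.card_Ico]
    have h1 : (0 : ℝ) ≤ 1 - 1 / n := by
      rw [sub_nonneg, div_le_one hn]
      exact_mod_cast NeZero.one_le
    have h2 := Real.one_sub_le_exp_neg (1 / (n : ℝ))
    refine (pow_le_pow_left₀ h1 h2 _).trans (le_of_eq ?_)
    rw [← Real.exp_nat_mul]
    congr 1
    ring
  refine (measureReal_mono hsub (measure_ne_top _ _)).trans
    ((measureReal_biUnion_finset_le _ _).trans ((Finset.sum_le_card_nsmul _ _ _ hv).trans ?_))
  rw [Finset.card_univ, Fintype.card_fin, nsmul_eq_mul]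

end Selection

/-! ### Transfer to the joint law and the total failure probability -/

section JointLaw

variable {V : Type*} [Fintype V] [DecidableEq V]

lemma measurable_graphOf : Measurable (graphOf : (Sym2 V ⊕ V → Bool) → SimpleGraph V) :=
  SimpleGraph.measurable_iff_adj.2 fun _ _ => Measurable.of_discrete

/-- Coins on diagonal pairs have no effect, since `fromEdgeSet` discards loops. -/
lemma map_coins_fromEdgeSet (p : unitInterval) :
    (coins (Sym2 V) p).map (fun x => SimpleGraph.fromEdgeSet {e | x e = true}) =
      SimpleGraph.binomialRandom V p := by
  have h := Measure.infinitePi_map_pi (fun _ : Sym2 V => bernoulliMeasure true false p)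
    (f := fun e b => b = true ∧ e ∈ Sym2.diagSetᶜ) (fun _ => .of_discrete)
  have h' : (fun e : Sym2 V => (bernoulliMeasure true false p).map
      (fun b => b = true ∧ e ∈ Sym2.diagSetᶜ)) = fun e =>
      unitInterval.toNNReal p • Measure.dirac (e ∈ Sym2.diagSetᶜ) +
        unitInterval.toNNReal (unitInterval.symm p) • Measure.dirac False := by
    funext e
    rw [map_bernoulliMeasure' _ _ .of_discrete, bernoulliMeasure_def]
    simp
  rw [SimpleGraph.binomialRandom_eq_map, setBernoulli_eq_map, ← h', ← h, Measure.map_map,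
    Measure.map_map]
  · congr 1
    funext x
    ext u v
    simp [SimpleGraph.fromEdgeSet_adj]
  · exact SimpleGraph.measurable_fromEdgeSet.comp MeasurableEquiv.setOfPred.measurable
  · exact .of_discrete
  · exact SimpleGraph.measurable_fromEdgeSet
  · exact MeasurableEquiv.setOfPred.measurable

lemma map_seedLaw (p q : unitInterval) :
    (seedLaw V p q).map (fun ω => (graphOf ω, beliefOf ω)) =
      (SimpleGraph.binomialRandom V p).prod
        (Measure.pi fun _ : V => bernoulliMeasure true false q) := by
  have hind := (iIndepFun_infinitePi (P := fun i : Sym2 V ⊕ V =>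
    bernoulliMeasure true false (Sum.elim (fun _ => p) (fun _ => q) i))
    (X := fun i ω => ω) (fun i => measurable_id)).indepFun_finset
      (Finset.univ.map ⟨Sum.inl, Sum.inl_injective⟩) (Finset.univ.map ⟨Sum.inr, Sum.inr_injective⟩)
      (by rw [Finset.disjoint_left]; rintro (e | a) <;> simp) (fun i => measurable_pi_apply i)
  have hind' := hind.comp
    (φ := fun x => SimpleGraph.fromEdgeSet {e : Sym2 V | x ⟨Sum.inl e, by simp⟩ = true})
    (ψ := fun x => fun v : V => x ⟨Sum.inr v, by simp⟩)
    (SimpleGraph.measurable_iff_adj.2 fun _ _ => Measurable.of_discrete) .of_discrete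
  have hind'' : IndepFun (graphOf : _ → SimpleGraph V) (beliefOf : _ → V → Bool)
      (seedLaw V p q) := hind'
  rw [(indepFun_iff_map_prod_eq_prod_map_map measurable_graphOf.aemeasurable
    Measurable.of_discrete.aemeasurable).1 hind'']
  have h1 := Measure.map_infinitePi_infinitePi_of_inj (P := fun i : Sym2 V ⊕ V =>
    bernoulliMeasure true false (Sum.elim (fun _ => p) (fun _ => q) i))
    (f := (Sum.inl : Sym2 V → Sym2 V ⊕ V)) Sum.inl_injective
  have h2 := Measure.map_infinitePi_infinitePi_of_inj (P := fun i : Sym2 V ⊕ V =>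
    bernoulliMeasure true false (Sum.elim (fun _ => p) (fun _ => q) i))
    (f := (Sum.inr : V → Sym2 V ⊕ V)) Sum.inr_injective
  congr 1
  · rw [← map_coins_fromEdgeSet]
    simp only [Sum.elim_inl] at h1
    rw [coins, ← h1, Measure.map_map
      (SimpleGraph.measurable_iff_adj.2 fun _ _ => Measurable.of_discrete) .of_discrete]
    rfl
  · rw [← Measure.infinitePi_eq_pi]
    exact h2

/-- The sample determined by the coins and the selections. -/
def sampleOf {n : ℕ} (x : (Sym2 (Fin n) ⊕ Fin n → Bool) × (ℕ → Fin n)) : Sample n :=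
  (graphOf x.1, beliefOf x.1, x.2)

lemma measurable_sampleOf {n : ℕ} : Measurable (sampleOf (n := n)) := by
  have h : Measurable fun ω : Sym2 (Fin n) ⊕ Fin n → Bool => beliefOf ω := .of_discrete
  exact (measurable_graphOf.comp measurable_fst).prodMk
    ((h.comp measurable_fst).prodMk measurable_snd)

lemma law_eq_map (n : ℕ) [NeZero n] (p q : unitInterval) :
    law n p q = ((seedLaw (Fin n) p q).prod (selectionLaw n)).map sampleOf := by
  have hΦ : Measurable fun ω : Sym2 (Fin n) ⊕ Fin n → Bool => (graphOf ω, beliefOf ω) :=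
    measurable_graphOf.prodMk .of_discrete
  rw [law, ← Measure.prodAssoc_prod, ← map_seedLaw]
  have h := Measure.map_prod_map (seedLaw (Fin n) p q) (selectionLaw n) hΦ measurable_id
  rw [Measure.map_id] at h
  rw [h, Measure.map_map (by fun_prop) (hΦ.prodMap measurable_id)]
  rfl

instance (n : ℕ) [NeZero n] (p q : unitInterval) : IsProbabilityMeasure (law n p q) := by
  rw [law_eq_map]
  exact Measure.isProbabilityMeasure_map measurable_sampleOf.aemeasurable

/-- The failure probability for given parameters: `a` is the length of the initial phase and
`10 * t₀` the number of rounds until the opinions are determined. -/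
noncomputable def failureBound (δ p : ℝ) (n a t₀ : ℕ) (b : ℝ) : ℝ :=
  Real.exp (-(drift δ ^ 2 / 8)) ^ a / (1 - Real.exp (-(drift δ ^ 2 / 8))) +
    (10 * t₀ + n) * Real.exp (-(p * drift δ ^ 2 * t₀ / 8)) +
    (10 * t₀ / (drift δ / 16 * n) + 10 * t₀ / n +
      n * Real.exp (-((⌊b⌋₊ - 10 * t₀ : ℕ) / n)))

/-- Integrates the bound for fixed selections over the sequences with few repeats and adds the
probabilities of bad sequences. In this form `Measure.le_map_apply` suffices, so the good event need
not be shown measurable. -/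
lemma one_le_law_add (n : ℕ) [NeZero n] {p q : unitInterval} (hp : (p : ℝ) ≤ 1 / 2) {δ : ℝ}
    (hδ : 0 < δ) (hδ' : δ < 1 / 2) (hq : (q : ℝ) = 1 / 2 + δ) {a t₀ : ℕ}
    (ha : (p : ℝ) * a ≤ δ / 2) (hat₀ : a ≤ t₀) (ht₀ : 1 ≤ t₀) {b : ℝ} (hb : 0 ≤ b) :
    1 ≤ law n p q (correctAtCouponTime n b) +
      ENNReal.ofReal (failureBound δ p n a t₀ b) := by
  set μ := seedLaw (Fin n) p q
  set σ := selectionLaw n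
  set η := drift δ / 16 with hη
  have hη0 : 0 < η := by have := drift_pos hδ; positivity
  set t₁ := 10 * t₀ with ht₁
  set R : Set (ℕ → Fin n) := {s | ∃ t ≤ t₁, η * t < repeats s t} with hR
  set L : Set (ℕ → Fin n) := {s | ∃ i < t₁, IsLastFrom t₁ s (s i)} with hL
  set M : Set (ℕ → Fin n) := {s | ∃ v, ∀ i, t₁ ≤ i → i < ⌊b⌋₊ → s i ≠ v} with hM
  set D : Set ((Sym2 (Fin n) ⊕ Fin n → Bool) × (ℕ → Fin n)) :=
    {x | x.2 ∉ R ∧ ∃ v, margin (graphOf x.1) (lowOf x.2 t₁ x.1) v ≤ 0} with hD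
  have hcover : (Set.univ : Set ((Sym2 (Fin n) ⊕ Fin n → Bool) × (ℕ → Fin n))) ⊆
      sampleOf ⁻¹' correctAtCouponTime n b ∪ (D ∪ Set.univ ×ˢ (R ∪ L ∪ M)) := by
    rintro ⟨ω, s⟩ -
    by_cases hbad : (ω, s) ∈ D ∪ Set.univ ×ˢ (R ∪ L ∪ M)
    · exact Or.inr hbad
    · left
      simp only [Set.mem_union, Set.mem_prod, Set.mem_univ, true_and, not_or] at hbad
      obtain ⟨h1, ⟨h2, h3⟩, h4⟩ := hbad
      have hpos : ∀ v, 0 < margin (graphOf ω) (announce (graphOf ω) (beliefOf ω) s t₁) v := by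
        intro v
        refine lt_of_lt_of_le ?_ (margin_low_le _ _ _ _ _)
        by_contra hcon
        exact h1 ⟨h2, v, not_lt.1 hcon⟩
      refine mem_correctAtCouponTime hb hpos (fun v => ?_) fun i hi hlast => h3 ⟨i, hi, hlast⟩
      by_contra hcon
      push Not at hcon
      exact h4 ⟨v, hcon⟩
  have hRm : MeasurableSet R := measurableSet_of_forall_lt (t := t₁) fun s s' h => by
    refine exists_congr fun t => and_congr_right fun ht => ?_
    rw [repeats_congr fun i hi => h i (by omega)]
  have hDm : MeasurableSet D := by
    refine measurableSet_setOfPred.2 (measurable_from_prod_countable_right fun ω => ?_)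
    refine measurableSet_setOfPred.1 (measurableSet_of_forall_lt (t := t₁) fun s s' h => ?_)
    have e1 : s ∈ R ↔ s' ∈ R := by
      refine exists_congr fun t => and_congr_right fun ht => ?_
      rw [repeats_congr fun i hi => h i (by omega)]
    have e2 : lowOf s t₁ ω = lowOf s' t₁ ω := low_congr _ _ h
    simp only [e1, e2]
  set d := Real.exp (-(drift δ ^ 2 / 8)) ^ a / (1 - Real.exp (-(drift δ ^ 2 / 8))) +
    (10 * t₀ + n) * Real.exp (-(p * drift δ ^ 2 * t₀ / 8)) with hd
  have hd0 : 0 ≤ d := by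
    have hlt : Real.exp (-(drift δ ^ 2 / 8)) < 1 := by
      rw [Real.exp_lt_one_iff]; nlinarith [sq_pos_of_pos (drift_pos hδ)]
    have : 0 < 1 - Real.exp (-(drift δ ^ 2 / 8)) := by linarith
    positivity
  have hDle : (μ.prod σ) D ≤ ENNReal.ofReal d := by
    rw [Measure.prod_apply_symm hDm]
    calc ∫⁻ s, μ ((fun ω => (ω, s)) ⁻¹' D) ∂σ ≤ ∫⁻ _, ENNReal.ofReal d ∂σ := by
          refine lintegral_mono fun s => ?_
          by_cases hs : s ∈ R
          · have : (fun ω => (ω, s)) ⁻¹' D = ∅ := by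
              ext ω
              simp only [hD, Set.mem_preimage, Set.mem_ofPred_eq, Set.mem_empty_iff_false,
                iff_false]
              exact fun h => h.1 hs
            simp only [this, measure_empty]
            exact zero_le
          · have hrep : ∀ t ≤ 10 * t₀, (repeats s t : ℝ) ≤ drift δ / 16 * t := by
              intro t ht
              by_contra hcon
              exact hs ⟨t, ht, not_le.1 hcon⟩
            have hmain := seedLaw_exists_margin_nonpos_le hp hδ hδ' hq ha hat₀ ht₀ hrep
            rw [Fintype.card_fin, ← hd] at hmain
            rw [← ENNReal.toReal_le_toReal (measure_ne_top _ _) ENNReal.ofReal_ne_top,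
              ENNReal.toReal_ofReal hd0]
            refine le_trans ?_ hmain
            rw [← measureReal_def]
            exact measureReal_mono (fun ω hω => hω.2) (measure_ne_top _ _)
      _ = ENNReal.ofReal d := by simp
  have hS : (μ.prod σ) (Set.univ ×ˢ (R ∪ L ∪ M)) ≤ ENNReal.ofReal
      (10 * t₀ / (η * n) + 10 * t₀ / n + n * Real.exp (-((⌊b⌋₊ - t₁ : ℕ) / n))) := by
    rw [Measure.prod_prod, measure_univ, one_mul, ← ofReal_measureReal]
    refine ENNReal.ofReal_le_ofReal ?_
    refine (measureReal_union_le _ _).trans (add_le_add ?_ (selectionLaw_exists_missed_le t₁ _))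
    refine (measureReal_union_le _ _).trans (add_le_add ?_ ?_)
    · exact (selectionLaw_many_repeats_le hη0 t₁).trans (le_of_eq (by rw [ht₁]; push_cast; rfl))
    · exact (selectionLaw_exists_isLastFrom_le t₁).trans (le_of_eq (by rw [ht₁]; push_cast; rfl))
  calc (1 : ENNReal) = (μ.prod σ) Set.univ := measure_univ.symm
    _ ≤ (μ.prod σ) (sampleOf ⁻¹' correctAtCouponTime n b) + ((μ.prod σ) D +
        (μ.prod σ) (Set.univ ×ˢ (R ∪ L ∪ M))) :=
      (measure_mono hcover).trans ((measure_union_le _ _).trans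
        (add_le_add le_rfl (measure_union_le _ _)))
    _ ≤ law n p q (correctAtCouponTime n b) + ENNReal.ofReal (failureBound δ p n a t₀ b) := by
      refine add_le_add ?_ ?_
      · rw [law_eq_map]
        exact Measure.le_map_apply measurable_sampleOf.aemeasurable _
      · refine (add_le_add hDle hS).trans ?_
        rw [← ENNReal.ofReal_add hd0 (by positivity)]
        rfl

end JointLaw

/-! ### Choice of the time scales and limits -/

section Asymptotics

open Filter Topology

/-- The length of the initial phase. -/
noncomputable def phaseLength (δ p : ℝ) : ℕ := ⌊δ / (2 * p)⌋₊

/-- The number of rounds after which new announcements are all correct. -/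
noncomputable def settleTime (δ p : ℝ) (n : ℕ) : ℕ :=
  ⌈16 * Real.log n / (drift δ ^ 2 * p)⌉₊

lemma eventually_pos_of_isLittleO {p : ℕ → ℝ} (hp0 : ∀ n, 0 ≤ p n)
    (hp : (fun n : ℕ => Real.log n / n) =o[atTop] p) : ∀ᶠ n in atTop, 0 < p n := by
  filter_upwards [hp.bound (zero_lt_one), eventually_gt_atTop 1] with n hn hn1
  rcases (hp0 n).lt_or_eq with h | h
  · exact h
  · exfalso
    rw [← h] at hn
    have hn1' : (1 : ℝ) < n := by exact_mod_cast hn1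
    have : 0 < Real.log n / n := div_pos (Real.log_pos hn1') (by linarith)
    simp only [norm_zero, mul_zero, Real.norm_eq_abs] at hn
    exact absurd (abs_pos.2 this.ne') (not_lt.2 hn)

/-- This is where p ≫ log n / n matters quantitatively: log n / p is o(n). -/
lemma tendsto_settleTime_div {δ : ℝ} {p : ℕ → ℝ} (hp0 : ∀ n, 0 ≤ p n)
    (hp : (fun n : ℕ => Real.log n / n) =o[atTop] p) :
    Tendsto (fun n : ℕ => (settleTime δ (p n) n : ℝ) / n) atTop (𝓝 0) := by
  have h1 : Tendsto (fun n : ℕ => 16 / drift δ ^ 2 * (Real.log n / n / p n) + 1 / (n : ℝ)) atTop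
      (𝓝 0) := by
    have := (hp.tendsto_div_nhds_zero.const_mul (16 / drift δ ^ 2)).add
      (tendsto_one_div_atTop_nhds_zero_nat (𝕜 := ℝ))
    simpa using this
  refine squeeze_zero' (.of_forall fun n => by positivity) ?_ h1
  filter_upwards [eventually_gt_atTop 0] with n hn
  have hn' : (0 : ℝ) < n := by exact_mod_cast hn
  have hlog : 0 ≤ Real.log n := Real.log_natCast_nonneg n
  have hpn := hp0 n
  have h2 : (settleTime δ (p n) n : ℝ) ≤ 16 * Real.log n / (drift δ ^ 2 * p n) + 1 :=
    (Nat.ceil_lt_add_one (by positivity)).le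
  calc (settleTime δ (p n) n : ℝ) / n ≤ (16 * Real.log n / (drift δ ^ 2 * p n) + 1) / n := by
        gcongr
    _ = _ := by
        rw [add_div]
        congr 1
        simp only [div_eq_mul_inv, mul_inv]
        ring

lemma tendsto_failureBound {δ : ℝ} (hδ : 0 < δ) {p : ℕ → ℝ} (hp0 : ∀ n, 0 ≤ p n)
    (hp_small : p =o[atTop] fun _ : ℕ => (1 : ℝ))
    (hp : (fun n : ℕ => Real.log n / n) =o[atTop] p) {ω : ℕ → ℝ} (hω : Tendsto ω atTop atTop) :
    Tendsto (fun n : ℕ => failureBound δ (p n) n (phaseLength δ (p n)) (settleTime δ (p n) n)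
      (n * (Real.log n + ω n))) atTop (𝓝 0) := by
  have hε := drift_pos hδ
  have hpos := eventually_pos_of_isLittleO hp0 hp
  have hT := tendsto_settleTime_div (δ := δ) hp0 hp
  have hinv := tendsto_one_div_atTop_nhds_zero_nat (𝕜 := ℝ)
  have h1 : Tendsto (fun n => Real.exp (-(drift δ ^ 2 / 8)) ^ phaseLength δ (p n) /
      (1 - Real.exp (-(drift δ ^ 2 / 8)))) atTop (𝓝 0) := by
    -- Since p tends to 0, the initial phase of order 1/p becomes long enough for the geometric tail
    -- to vanish.
    have ha : Tendsto (fun n => phaseLength δ (p n)) atTop atTop := by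
      refine tendsto_nat_floor_atTop.comp ?_
      have hp' : Tendsto p atTop (𝓝[>] 0) := by
        refine tendsto_nhdsWithin_iff.2 ⟨?_, hpos⟩
        simpa using hp_small.tendsto_div_nhds_zero
      have := (tendsto_inv_nhdsGT_zero.comp hp').const_mul_atTop (half_pos hδ)
      refine this.congr fun n => ?_
      simp only [Function.comp, div_eq_mul_inv, mul_inv]
      ring
    have hx : Real.exp (-(drift δ ^ 2 / 8)) < 1 := by
      rw [Real.exp_lt_one_iff]; nlinarith [sq_pos_of_pos hε]
    have := ((tendsto_pow_atTop_nhds_zero_of_lt_one (Real.exp_pos _).le hx).comp ha).div_const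
      (1 - Real.exp (-(drift δ ^ 2 / 8)))
    simpa [Function.comp_def] using this
  have h2 : Tendsto (fun n => (10 * (settleTime δ (p n) n : ℝ) + n) *
      Real.exp (-(p n * drift δ ^ 2 * settleTime δ (p n) n / 8))) atTop (𝓝 0) := by
    have hlim : Tendsto (fun n : ℕ => (10 * ((settleTime δ (p n) n : ℝ) / n) + 1) * (1 / (n : ℝ)))
        atTop (𝓝 0) := by
      have := ((hT.const_mul 10).add_const 1).mul hinv
      simpa using this
    refine squeeze_zero' (.of_forall fun n => by positivity) ?_ hlim
    filter_upwards [hpos, eventually_gt_atTop 0] with n hpn hn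
    have hn' : (0 : ℝ) < n := by exact_mod_cast hn
    have hceil : 16 * Real.log n / (drift δ ^ 2 * p n) ≤ settleTime δ (p n) n := Nat.le_ceil _
    rw [div_le_iff₀ (by positivity)] at hceil
    -- The constant 16 in `settleTime` against the 8 here gives n⁻², which beats a union bound over
    -- 10t₀ + n events.
    have hexp : Real.exp (-(p n * drift δ ^ 2 * settleTime δ (p n) n / 8)) ≤ 1 / (n : ℝ) ^ 2 := by
      have : 1 / (n : ℝ) ^ 2 = Real.exp (-(2 * Real.log n)) := by
        rw [Real.exp_neg, two_mul, Real.exp_add, Real.exp_log hn', one_div, sq]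
      rw [this, Real.exp_le_exp]
      nlinarith
    calc (10 * (settleTime δ (p n) n : ℝ) + n) *
          Real.exp (-(p n * drift δ ^ 2 * settleTime δ (p n) n / 8))
        ≤ (10 * (settleTime δ (p n) n : ℝ) + n) * (1 / (n : ℝ) ^ 2) := by gcongr
      _ = _ := by field_simp
  have h3 : Tendsto (fun n : ℕ => 10 * (settleTime δ (p n) n : ℝ) / (drift δ / 16 * n)) atTop
      (𝓝 0) := by
    have := hT.const_mul (10 / (drift δ / 16))
    rw [mul_zero] at this
    refine this.congr fun n => ?_
    rw [div_mul_div_comm]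
  have h4 : Tendsto (fun n : ℕ => 10 * (settleTime δ (p n) n : ℝ) / n) atTop (𝓝 0) := by
    have := hT.const_mul 10
    rw [mul_zero] at this
    refine this.congr fun n => ?_
    rw [mul_div_assoc]
  have h5 : Tendsto (fun n : ℕ => n * Real.exp (-(((⌊n * (Real.log n + ω n)⌋₊ -
      10 * settleTime δ (p n) n : ℕ) : ℝ) / n))) atTop (𝓝 0) := by
    -- The discarded first 10t₀ rounds and the floor change the exponent by o(1) only.
    have hlim : Tendsto (fun n : ℕ => Real.exp (-ω n + (10 * (settleTime δ (p n) n : ℝ) / n +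
        1 / (n : ℝ)))) atTop (𝓝 0) := by
      refine Real.tendsto_exp_atBot.comp ?_
      exact (tendsto_neg_atTop_atBot.comp hω).atBot_add (h4.add hinv)
    refine squeeze_zero' (.of_forall fun n => by positivity) ?_ hlim
    filter_upwards [eventually_gt_atTop 0] with n hn
    have hn' : (0 : ℝ) < n := by exact_mod_cast hn
    have hsub : (n * (Real.log n + ω n)) - 1 - 10 * (settleTime δ (p n) n : ℝ) ≤
        ((⌊n * (Real.log n + ω n)⌋₊ - 10 * settleTime δ (p n) n : ℕ) : ℝ) := by
      have hfl := (Nat.sub_one_lt_floor (n * (Real.log n + ω n))).le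
      have hle : (⌊n * (Real.log n + ω n)⌋₊ : ℝ) ≤
          ((⌊n * (Real.log n + ω n)⌋₊ - 10 * settleTime δ (p n) n : ℕ) : ℝ) +
            10 * (settleTime δ (p n) n : ℝ) := by
        exact_mod_cast Nat.sub_le_iff_le_add.1 le_rfl
      linarith
    calc n * Real.exp (-(((⌊n * (Real.log n + ω n)⌋₊ - 10 * settleTime δ (p n) n : ℕ) : ℝ) / n))
        = Real.exp (Real.log n + -(((⌊n * (Real.log n + ω n)⌋₊ -
            10 * settleTime δ (p n) n : ℕ) : ℝ) / n)) := by
          rw [Real.exp_add, Real.exp_log hn']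
      _ ≤ _ := by
          rw [Real.exp_le_exp]
          have := div_le_div_of_nonneg_right hsub hn'.le
          have e : (n * (Real.log n + ω n) - 1 - 10 * (settleTime δ (p n) n : ℝ)) / n =
              Real.log n + ω n - 1 / n - 10 * (settleTime δ (p n) n : ℝ) / n := by
            field_simp
          rw [e] at this
          linarith
  have := (h1.add h2).add ((h3.add h4).add h5)
  simpa [failureBound] using this

end Asymptotics

end MajorityDynamics

/-! ### The main theorem -/

open MajorityDynamics in
theorem theorem1 (δ : ℝ) (hδ : δ ∈ Set.Ioo (0 : ℝ) (1 / 2))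
    (p : ℕ → unitInterval)
    (hp_small : (fun n : ℕ => (p n : ℝ)) =o[Filter.atTop] fun _ : ℕ => (1 : ℝ))
    (hp_large : (fun n : ℕ => Real.log n / n) =o[Filter.atTop] fun n : ℕ => (p n : ℝ))
    (ω' : ℕ → ℝ) (hω'_tendsto : Filter.Tendsto ω' Filter.atTop Filter.atTop)
    (hω'_small : ω' =o[Filter.atTop] fun n : ℕ => Real.log n) :
    Asymptotics.IsEquivalent Filter.atTop
        (fun n : ℕ => n * (Real.log n + ω' n)) (fun n : ℕ => n * Real.log n) ∧
      Filter.Tendsto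
        (fun n : ℕ => MajorityDynamics.law n (p n) (MajorityDynamics.correctProb δ hδ)
          (MajorityDynamics.correctAtCouponTime n (n * (Real.log n + ω' n))))
        Filter.atTop (nhds 1) := by
  refine ⟨?_, ?_⟩
  · have h : (fun n : ℕ => (n : ℝ) * ω' n) =o[Filter.atTop] fun n : ℕ => (n : ℝ) * Real.log n :=
      (Asymptotics.isBigO_refl _ _).mul_isLittleO hω'_small
    refine h.congr_left fun n => ?_
    simp only [Pi.sub_apply]
    ring
  have hp0 : ∀ n, (0 : ℝ) ≤ p n := fun n => (p n).2.1
  have hfail := tendsto_failureBound hδ.1 hp0 hp_small hp_large hω'_tendsto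
  have hfail' := ENNReal.tendsto_ofReal hfail
  rw [ENNReal.ofReal_zero] at hfail'
  have hlow := ENNReal.Tendsto.sub (tendsto_const_nhds (x := (1 : ENNReal))) hfail'
    (Or.inl ENNReal.one_ne_top)
  rw [tsub_zero] at hlow
  have hhalf : ∀ᶠ n in Filter.atTop, (p n : ℝ) ≤ 1 / 2 := by
    filter_upwards [hp_small.bound (show (0 : ℝ) < 1 / 2 by norm_num)] with n hn
    simpa [abs_of_nonneg (hp0 n)] using hn
  have hlog : ∀ᶠ n : ℕ in Filter.atTop, 1 ≤ Real.log n :=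
    (Real.tendsto_log_atTop.comp tendsto_natCast_atTop_atTop).eventually_ge_atTop 1
  refine tendsto_of_tendsto_of_tendsto_of_le_of_le' hlow tendsto_const_nhds ?_ ?_
  · filter_upwards [eventually_pos_of_isLittleO hp0 hp_large, hhalf, hlog,
      Filter.eventually_gt_atTop 0, hω'_tendsto.eventually_ge_atTop 0] with n hpn hpn' hlogn hn hωn
    have : NeZero n := ⟨hn.ne'⟩
    have hε := drift_pos hδ.1
    have hε1 := drift_le δ
    have ha : (p n : ℝ) * phaseLength δ (p n) ≤ δ / 2 := by
      have h1 : (phaseLength δ (p n) : ℝ) ≤ δ / (2 * p n) :=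
        Nat.floor_le (div_nonneg hδ.1.le (by positivity))
      rw [le_div_iff₀ (by positivity)] at h1
      linarith
    -- Both scales carry 1/p, so this reduces to comparing constants, using log n ≥ 1.
    have hat₀ : phaseLength δ (p n) ≤ settleTime δ (p n) n := by
      have h1 : δ / (2 * p n) ≤ 16 * Real.log n / (drift δ ^ 2 * p n) := by
        rw [div_le_div_iff₀ (by positivity) (by positivity)]
        have h2 : δ * drift δ ^ 2 ≤ 1 := by nlinarith [hδ.1, hδ.2]
        nlinarith
      exact (Nat.floor_le_floor h1).trans (Nat.floor_le_ceil _)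
    have ht₀ : 1 ≤ settleTime δ (p n) n := Nat.one_le_ceil_iff.2 (by positivity)
    rw [tsub_le_iff_right]
    exact one_le_law_add n hpn' hδ.1 hδ.2 rfl ha hat₀ ht₀
      (mul_nonneg (Nat.cast_nonneg n) (by linarith))
  · filter_upwards [Filter.eventually_gt_atTop 0] with n hn
    have : NeZero n := ⟨hn.ne'⟩
    exact prob_le_one
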